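/- **Setting.** Let $c,d$ be positive integers and $\alpha,\delta\in(0,1]$. A $(c,d,\alpha,\delta)$-bipartite expander is a bipartite graph $G=(L\cup R,E)$ in which every vertex of $L$ has degree $c$, every vertex of $R$ has degree $d$, and $|N(S)|\ge \delta c|S|$ for every $S\subseteq L$ with $|S|\le\alpha|L|$. Let $L=[n]$ with $n\ge 1$, and fix for each $v\in R$ a total ordering $N(v,1),\dots,N(v,d)$ of its neighbourhood $N(v)$. For $x\in\mathbb F_2^n$ put $x_{N(v)}=(x_{N(v,1)},\dots,x_{N(v,d)})\in\mathbb F_2^d$. Let $C_0\subseteq\mathbb F_2^d$ be a linear code with minimum distance $d_0$. The Tanner code is $T(G,C_0)=\{x\in\mathbb F_2^n: x_{N(v)}\in C_0\text{ for all }v\in R\}$, and $U(x)=\{v\in R: x_{N(v)}\notin C_0\}$ is the set of unsatisfied checks of $x$. Write $d_H$ for the Hamming distance, and for $w\in\mathbb F_2^d$ let $\mathsf{Decode}(w)$ be the codeword of $C_0$ closest to $w$, ties being broken by taking the lexicographically smallest one. **Algorithms.** $\mathsf{RandFlip}(x)$: let $t=d_0/2$ and start with $p_i=0$ for all $i\in[n]$.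 For each $v\in R$ let $w_v=\mathsf{Decode}(x_{N(v)})$; if $1\le d_H(w_v,x_{N(v)})<t$, then add $\frac{t-d_H(w_v,x_{N(v)})}{ct}$ to $p_i$, where $i$ is the smallest element of $N(v)$ (in its fixed ordering) at which $w_v$ and $x_{N(v)}$ differ. (One has $p_i\in[0,1]$ at the end.) Then, independently for each $i\in[n]$, flip $x_i$ with probability $p_i$, and return $x$. $\mathsf{RandDecode}(x)$: while $|U(x)|>0$, replace $x$ by $\mathsf{RandFlip}(x)$; then return $x$. **Machine model.** Running time is the number of steps on a randomized random access machine with unit cost for memory access, for addition, truncated subtraction and comparison of natural numbers, and for drawing a uniformly random element of $\{0,\dots,k\}$, $k$ a constant. The input consists of $x$ and of the adjacency lists of the vertices of $G$ (those of $v\in R$ in the fixed ordering). **Theorem.** Let $c,d\ge 1$ be integers. For every linear code $C_0\subseteq \mathbb F_2^d$ there is a program $P_{C_0}$ for this machine which implements $\mathsf{RandDecode}$: for all $n\geq 1$, all $(c,d)$-regular bipartite graphs $G$ with $L=[n]$ and given adjacency lists, and all $x,z\in\mathbb F_2^n$, the probability that $P_{C_0}$ halts with output $z$ on the input $x$ equals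 the probability that $\mathsf{RandDecode}(x)$ terminates with output $z$. Moreover, for all $\alpha,\delta\in(0,1]$ there are a constant $K$ and a function $\eta:\mathbb N\to\mathbb R$ with $\eta(n)\to0$ as $n\to\infty$, depending only on $c,d,\alpha,\delta$, such that the following holds. Let $C_0\subseteq\mathbb F_2^d$ be a linear code with minimum distance $d_0$ such that $\delta d_0>2$, let $n\ge1$, let $G$ be a $(c,d,\alpha,\delta)$-bipartite expander with $L=[n]$, and let $x\in\mathbb F_2^n$ and $y\in T(G,C_0)$ satisfy $d_H(x,y)\le\alpha n$. Then, with probability at least $1-\eta(n)$, $\mathsf{RandDecode}(x)$ terminates with output $y$; and, with probability at least $1-\eta(n)$, $P_{C_0}$ on the input $x$ outputs $y$ and halts within $Kn$ steps. -/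

import Mathlib

open Filter Topology
open scoped ENNReal

namespace ExpanderDecoding

/-! ### Codes -/

/-- The minimum distance of a Boolean linear code.  (It is `0` for the zero code, which has no two
distinct codewords.) -/
noncomputable def minDist {d : ℕ} (C : Submodule (ZMod 2) (Fin d → ZMod 2)) : ℕ :=
  sInf {k | ∃ x ∈ C, ∃ y ∈ C, x ≠ y ∧ hammingDist x y = k}

/-- The key by which candidates for the decoding of `w` are compared: first the Hamming distance
from `w`, then the lexicographic order of words. -/
def decodeKey {d : ℕ} (w z : Fin d → ZMod 2) : ℕ ×ₗ Lex (Fin d → ℕ) :=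
  toLex (hammingDist w z, toLex fun i => (z i).val)

/-- `Decode(w)`: the codeword of `C` closest to `w`, ties being broken by taking the
lexicographically smallest one. -/
noncomputable def decode {d : ℕ} (C : Submodule (ZMod 2) (Fin d → ZMod 2))
    (w : Fin d → ZMod 2) : Fin d → ZMod 2 :=
  Function.argminOn (decodeKey w) (C : Set (Fin d → ZMod 2)) ⟨0, C.zero_mem⟩

/-! ### Bipartite graphs, expanders, Tanner codes -/

/-- A (simple) bipartite graph with left vertex set `L = Fin n` and right vertex set
`R = Fin m`. -/
structure BipGraph (n m : ℕ) where
  Adj : Fin n → Fin m → Prop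

/-- The neighbourhood `N(S)` of a set `S` of left vertices. -/
def BipGraph.nbhd {n m : ℕ} (G : BipGraph n m) (S : Set (Fin n)) : Set (Fin m) :=
  {v | ∃ u ∈ S, G.Adj u v}

/-- `(c, d, α, δ)`-bipartite expanders. -/
structure BipGraph.IsExpander {n m : ℕ} (G : BipGraph n m) (c d : ℕ) (α δ : ℝ) : Prop where
  left_regular : ∀ u, {v | G.Adj u v}.ncard = c
  right_regular : ∀ v, {u | G.Adj u v}.ncard = d
  expansion : ∀ S : Set (Fin n), (S.ncard : ℝ) ≤ α * n →
    δ * c * (S.ncard : ℝ) ≤ ((G.nbhd S).ncard : ℝ)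

/-- Adjacency lists of a `(c, d)`-regular bipartite graph: `right v i` is the `i`-th element
`N(v, i)` in a fixed total ordering of the neighbourhood `N(v)` of the right vertex `v`, and
`left u` lists the neighbours of the left vertex `u` in some order. -/
structure AdjLists {n m : ℕ} (G : BipGraph n m) (c d : ℕ) where
  right : ∀ v : Fin m, Fin d ≃ {u : Fin n // G.Adj u v}
  left : ∀ u : Fin n, Fin c ≃ {v : Fin m // G.Adj u v}

section Tanner

variable {n m c d : ℕ} {G : BipGraph n m} (A : AdjLists G c d)
  (C : Submodule (ZMod 2) (Fin d → ZMod 2))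

/-- The local view `x_{N(v)}`. -/
def localView (x : Fin n → ZMod 2) (v : Fin m) : Fin d → ZMod 2 :=
  fun i => x (A.right v i)

/-- The Tanner code `T(G, C)`. -/
def tannerCode : Submodule (ZMod 2) (Fin n → ZMod 2) where
  carrier := {x | ∀ v, localView A x v ∈ C}
  add_mem' := fun hx hy v => C.add_mem (hx v) (hy v)
  zero_mem' := fun _ => C.zero_mem
  smul_mem' := fun a _ hx v => C.smul_mem a (hx v)

/-- The set `U(x)` of unsatisfied checks. -/
def unsat (x : Fin n → ZMod 2) : Set (Fin m) :=
  {v | localView A x v ∉ C}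

/-! ### The algorithms `RandFlip` and `RandDecode` -/

/-- The distance `d_H(w_v, x_{N(v)})`, where `w_v = Decode(x_{N(v)})`. -/
noncomputable def localDist (x : Fin n → ZMod 2) (v : Fin m) : ℕ :=
  hammingDist (decode C (localView A x v)) (localView A x v)

/-- `u` is the smallest element of `N(v)`, in the total ordering fixed on `N(v)`, at which
`w_v` and `x_{N(v)}` differ. -/
def IsFirstDiff (x : Fin n → ZMod 2) (v : Fin m) (u : Fin n) : Prop :=
  ∃ i : Fin d, (A.right v i : Fin n) = u ∧
    decode C (localView A x v) i ≠ localView A x v i ∧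
    ∀ j < i, decode C (localView A x v) j = localView A x v j

open Classical in
/-- The amount that the check `v` adds to `p_u`; here `t = d₀ / 2`. -/
noncomputable def vote (x : Fin n → ZMod 2) (v : Fin m) (u : Fin n) : ℝ :=
  let t : ℝ := (minDist C : ℝ) / 2
  if 1 ≤ localDist A C x v ∧ (localDist A C x v : ℝ) < t ∧ IsFirstDiff A C x v u then
    (t - localDist A C x v) / (c * t)
  else 0

/-- The flipping probability `p_u` computed by `RandFlip(x)`. -/
noncomputable def flipProb (x : Fin n → ZMod 2) (u : Fin n) : ℝ :=
  ∑ v, vote A C x v u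

theorem vote_nonneg (x : Fin n → ZMod 2) (v : Fin m) (u : Fin n) : 0 ≤ vote A C x v u := by
  unfold vote
  dsimp only
  split_ifs with h
  · have := h.2.1
    apply div_nonneg (by linarith)
    positivity
  · exact le_rfl

theorem vote_le (x : Fin n → ZMod 2) (v : Fin m) (u : Fin n) :
    vote A C x v u ≤ 1 / c := by
  unfold vote
  dsimp only
  split_ifs with h
  · have h1 : (0 : ℝ) ≤ localDist A C x v := by positivity
    have h2 := lt_of_le_of_lt h1 h.2.1
    rw [mul_comm, ← div_div]
    gcongr
    rw [div_le_one h2]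
    linarith
  · positivity

theorem vote_eq_zero (x : Fin n → ZMod 2) (v : Fin m) (u : Fin n) (h : ¬ G.Adj u v) :
    vote A C x v u = 0 := by
  unfold vote
  dsimp only
  rw [if_neg]
  rintro ⟨-, -, i, hi, -⟩
  exact h (hi ▸ (A.right v i).2)

theorem flipProb_nonneg (x : Fin n → ZMod 2) (u : Fin n) : 0 ≤ flipProb A C x u :=
  Finset.sum_nonneg fun v _ => vote_nonneg A C x v u

theorem flipProb_le_one (x : Fin n → ZMod 2) (u : Fin n) : flipProb A C x u ≤ 1 := by
  classical
  have hcard : (Finset.univ.filter fun v => G.Adj u v).card = c := by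
    rw [← Fintype.card_subtype, ← Fintype.card_congr (A.left u), Fintype.card_fin]
  have h1 : flipProb A C x u = ∑ v ∈ Finset.univ.filter (fun v => G.Adj u v), vote A C x v u := by
    rw [Finset.sum_filter_of_ne]
    · rfl
    · intro v _ hv
      by_contra hn
      exact hv (vote_eq_zero A C x v u hn)
  rw [h1]
  refine (Finset.sum_le_card_nsmul _ _ _ fun v _ => vote_le A C x v u).trans ?_
  rw [hcard, nsmul_eq_mul, mul_one_div]
  exact div_self_le_one _

/-- The probability that `RandFlip(x)` gives the `u`-th bit the value `b`. -/
noncomputable def bitProb (x : Fin n → ZMod 2) (u : Fin n) (b : ZMod 2) : ℝ≥0∞ :=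
  if b = x u then ENNReal.ofReal (1 - flipProb A C x u) else ENNReal.ofReal (flipProb A C x u)

theorem sum_bitProb (x : Fin n → ZMod 2) (u : Fin n) : ∑ b, bitProb A C x u b = 1 := by
  have h : ENNReal.ofReal (1 - flipProb A C x u) + ENNReal.ofReal (flipProb A C x u) = 1 := by
    rw [← ENNReal.ofReal_add (sub_nonneg.2 (flipProb_le_one A C x u)) (flipProb_nonneg A C x u)]
    simp
  have h2 : ∀ a : ZMod 2, a = 0 ∨ a = 1 := by decide
  have h3 : (Finset.univ : Finset (ZMod 2)) = {0, 1} := by decide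
  unfold bitProb
  rw [h3, Finset.sum_pair (by decide)]
  rcases h2 (x u) with h0 | h0
  · simpa [h0] using h
  · rw [h0, add_comm]
    simpa using h

theorem sum_prod_bitProb (x : Fin n → ZMod 2) :
    ∑ z : Fin n → ZMod 2, ∏ u, bitProb A C x u (z u) = 1 := by
  rw [← Fintype.prod_sum]
  simp [sum_bitProb]

/-- The output distribution of `RandFlip(x)`: independently for every `u`, the bit `x_u` is
flipped with probability `p_u`. -/
noncomputable def randFlip (x : Fin n → ZMod 2) : PMF (Fin n → ZMod 2) :=
  PMF.ofFintype (fun z => ∏ u, bitProb A C x u (z u)) (sum_prod_bitProb A C x)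

open Classical in
/-- The distribution of the current word of `RandDecode(x)` after at most `k` executions of the
loop body (the loop is left as soon as there are no unsatisfied checks). -/
noncomputable def randDecodeIter (x : Fin n → ZMod 2) : ℕ → PMF (Fin n → ZMod 2)
  | 0 => PMF.pure x
  | k + 1 => (randDecodeIter x k).bind fun z =>
      if 0 < (unsat A C z).ncard then randFlip A C z else PMF.pure z

/-- The probability that `RandDecode(x)` terminates and outputs `z`. -/
noncomputable def randDecodeProb (x z : Fin n → ZMod 2) : ℝ≥0∞ :=
  ⨆ k, (randDecodeIter A C x k).toOuterMeasure {z' | z' = z ∧ (unsat A C z').ncard = 0}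

end Tanner

/-! ### A randomized random access machine

Registers and memory cells hold natural numbers.  The memory is divided into arrays, of which a
program, being a finite text, can name only finitely many.  The arithmetic operations are addition,
truncated subtraction and comparison. -/

/-- Array names: the arrays holding the input word and the adjacency lists, and work arrays. -/
inductive Arr
  | word
  | rightNbr (i : ℕ)
  | leftNbr (j : ℕ)
  | work (k : ℕ)
  deriving DecidableEq

/-- Expressions: constants, registers, array cells, arithmetic, and comparisons
(with value `1` for true and `0` for false). -/
inductive Expr
  | lit (k : ℕ)
  | reg (r : ℕ)
  | get (a : Arr) (e : Expr)
  | add (e f : Expr)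
  | sub (e f : Expr)
  | eq (e f : Expr)
  | lt (e f : Expr)

/-- Programs.  `assign r e` is `r := e`, `store a e f` is `a[e] := f`, and `rand r k` puts a uniformly
random element of `{0, …, k}` into the register `r`. -/
inductive Prog
  | skip
  | assign (r : ℕ) (e : Expr)
  | store (a : Arr) (e f : Expr)
  | rand (r k : ℕ)
  | seq (p q : Prog)
  | ite (e : Expr) (p q : Prog)
  | while (e : Expr) (p : Prog)

/-- The contents of the registers and of the arrays. -/
structure State where
  reg : ℕ → ℕ
  arr : Arr → ℕ → ℕ

def State.setReg (s : State) (r k : ℕ) : State :=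
  { s with reg := Function.update s.reg r k }

def State.setArr (s : State) (a : Arr) (i k : ℕ) : State :=
  { s with arr := Function.update s.arr a (Function.update (s.arr a) i k) }

def Expr.eval (s : State) : Expr → ℕ
  | .lit k => k
  | .reg r => s.reg r
  | .get a e => s.arr a (e.eval s)
  | .add e f => e.eval s + f.eval s
  | .sub e f => e.eval s - f.eval s
  | .eq e f => if e.eval s = f.eval s then 1 else 0
  | .lt e f => if e.eval s < f.eval s then 1 else 0

/-- A configuration of the machine: the list of the program parts that remain to be executed, and
the state.  The machine has halted when nothing remains. -/
structure Config where
  todo : List Prog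
  state : State

/-- One step of the machine, which takes one unit of time.  (The size of an expression is bounded
by a constant depending only on the program, hence a step amounts to a constant number of
elementary operations.) -/
noncomputable def step : Config → PMF Config
  | ⟨[], s⟩ => PMF.pure ⟨[], s⟩
  | ⟨.skip :: l, s⟩ => PMF.pure ⟨l, s⟩
  | ⟨.assign r e :: l, s⟩ => PMF.pure ⟨l, s.setReg r (e.eval s)⟩
  | ⟨.store a e f :: l, s⟩ => PMF.pure ⟨l, s.setArr a (e.eval s) (f.eval s)⟩
  | ⟨.rand r k :: l, s⟩ =>
      (PMF.uniformOfFintype (Fin (k + 1))).map fun j => ⟨l, s.setReg r j⟩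
  | ⟨.seq p q :: l, s⟩ => PMF.pure ⟨p :: q :: l, s⟩
  | ⟨.ite e p q :: l, s⟩ => PMF.pure ⟨(if e.eval s ≠ 0 then p else q) :: l, s⟩
  | ⟨.while e p :: l, s⟩ =>
      PMF.pure ⟨if e.eval s ≠ 0 then p :: .while e p :: l else l, s⟩

/-- The distribution of the configuration after `T` steps. -/
noncomputable def runSteps (T : ℕ) (κ : Config) : PMF Config :=
  match T with
  | 0 => PMF.pure κ
  | T + 1 => (runSteps T κ).bind step

/-- The initial state.  Register `0` holds `n` and register `1` holds `m`; the array `word` holds the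
bits of `x`; `rightNbr i` holds at position `v` the `i`-th element of the adjacency list of the
right vertex `v`, and `leftNbr j` holds at position `u` the `j`-th element of the adjacency list
of the left vertex `u`.  (Vertices are numbered from `0`.)  Everything else is `0`. -/
def inputState {n m c d : ℕ} {G : BipGraph n m} (A : AdjLists G c d) (x : Fin n → ZMod 2) :
    State where
  reg r := if r = 0 then n else if r = 1 then m else 0
  arr
    | .word, u => if h : u < n then (x ⟨u, h⟩).val else 0
    | .rightNbr i, v =>
        if h : v < m ∧ i < d then ((A.right ⟨v, h.1⟩ ⟨i, h.2⟩ : Fin n) : ℕ) else 0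
    | .leftNbr j, u =>
        if h : u < n ∧ j < c then ((A.left ⟨u, h.1⟩ ⟨j, h.2⟩ : Fin m) : ℕ) else 0
    | .work _, _ => 0

/-- The probability that the program `P`, on the input consisting of the word `x` and the adjacency
lists `A`, halts within `T` steps with the word `z` in the array `word`. -/
noncomputable def outputProb {n m c d : ℕ} {G : BipGraph n m} (P : Prog) (A : AdjLists G c d)
    (x : Fin n → ZMod 2) (T : ℕ) (z : Fin n → ZMod 2) : ℝ≥0∞ :=
  (runSteps T ⟨[P], inputState A x⟩).toOuterMeasure
    {κ | κ.todo = [] ∧ ∀ u : Fin n, κ.state.arr .word u = (z u).val}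

/-- `P` is an implementation of `RandDecode` for the inner code `C` on `(c, d)`-regular graphs: on
every input, the probability that it (ever) halts with output `z` is the probability that `RandDecode`
terminates with output `z`. -/
def ImplementsRandDecode (P : Prog) (c d : ℕ) (C : Submodule (ZMod 2) (Fin d → ZMod 2)) : Prop :=
  ∀ (n m : ℕ) (G : BipGraph n m) (A : AdjLists G c d) (x z : Fin n → ZMod 2), 0 < n →
    ⨆ T, outputProb P A x T z = randDecodeProb A C x z

end ExpanderDecoding

namespace ExpanderDecoding

/-! ### Running the machine -/

/-! Let `D` be the distance of the current word from `y`, with `D ≤ αn`, and let `t = d₀/2`. A check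
with `e > 0` errors in its view contributes at least `(t - e)/(ct)` to the expected decrease of `D`,
whether its local decoding is right, wrong or without a vote (`le_sum_signed_vote`). Summing over
the checks and applying expansion to the set of errors gives an expected decrease of at least `(δ -
2/d₀)D ≥ εD` (`drift_le`). The flips are independent, so the variance of the new distance is at most
the sum of the flipping probabilities, which is at most `D` (`sum_sq_deviation_le`).

Charge `D` units of work to each round and let `b` be the work still allowed. Then `D - εb` does not
increase on average. Failure means that `b` falls below `D` or that the distance exceeds `αn`. By
second-moment bounds each round adds `O(D/n²)` to the failure probability, while the total of the
`D`'s is `O(n)` on average, so failure has probability `O(1/n)`. The function `potential` packs both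
estimates into one quantity that does not increase on average (`sum_potential_le`), and
`success_le_haltProb` is then an induction on `b`, with no stopping times.

For linear time a round must cost `O(D)` rather than `O(n)`. The program keeps a queue of the
neighbours of unsatisfied checks. It has at most `dcD` entries (`Ready.length_le`), contains every
bit that can flip, and can be rebuilt from its predecessor (`flipRound_reaches`). Flipping
probabilities are multiples of `1/(c d₀)`, so one uniform draw realizes each of them exactly. Since
running times vary between branches, program and algorithm are compared through two-sided bounds on
halting probabilities (`Reaches`). The bound for `RandDecode` itself then follows from the bound for
the program. -/

theorem runSteps_add (a b : ℕ) (κ : Config) :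
    runSteps (a + b) κ = (runSteps a κ).bind (runSteps b) := by
  induction b with
  | zero =>
    change runSteps a κ = (runSteps a κ).bind PMF.pure
    rw [PMF.bind_pure]
  | succ b ih =>
    change (runSteps (a + b) κ).bind step = _
    rw [ih, PMF.bind_bind]
    rfl

theorem runSteps_one (κ : Config) : runSteps 1 κ = step κ := by
  change (PMF.pure κ).bind step = _
  rw [PMF.pure_bind]

/-- The machine goes deterministically from `κ` to `κ'` in at most `N` steps. -/
def Steps (N : ℕ) (κ κ' : Config) : Prop :=
  ∃ a ≤ N, runSteps a κ = PMF.pure κ'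

theorem Steps.refl (κ : Config) : Steps 0 κ κ := ⟨0, le_rfl, rfl⟩

theorem Steps.trans {M N : ℕ} {κ κ' κ'' : Config} (h : Steps M κ κ') (h' : Steps N κ' κ'') :
    Steps (M + N) κ κ'' := by
  obtain ⟨a, ha, h⟩ := h
  obtain ⟨b, hb, h'⟩ := h'
  exact ⟨a + b, add_le_add ha hb, by rw [runSteps_add, h, PMF.pure_bind, h']⟩

theorem Steps.mono {M N : ℕ} {κ κ' : Config} (h : Steps M κ κ') (hMN : M ≤ N) : Steps N κ κ' :=
  ⟨h.choose, h.choose_spec.1.trans hMN, h.choose_spec.2⟩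

theorem Steps.of_step {κ κ' : Config} (h : step κ = PMF.pure κ') : Steps 1 κ κ' :=
  ⟨1, le_rfl, by rw [runSteps_one, h]⟩

theorem Steps.cons {N : ℕ} {κ κ' κ'' : Config} (h : step κ = PMF.pure κ') (h' : Steps N κ' κ'') :
    Steps (N + 1) κ κ'' :=
  ((Steps.of_step h).trans h').mono (by omega)

section Rules

variable {N : ℕ} {l : List Prog} {s : State} {κ : Config}

theorem Steps.skip : Steps 1 ⟨.skip :: l, s⟩ ⟨l, s⟩ := .of_step rfl

theorem Steps.assign {r : ℕ} {e : Expr} :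
    Steps 1 ⟨.assign r e :: l, s⟩ ⟨l, s.setReg r (e.eval s)⟩ := .of_step rfl

theorem Steps.store {a : Arr} {e f : Expr} :
    Steps 1 ⟨.store a e f :: l, s⟩ ⟨l, s.setArr a (e.eval s) (f.eval s)⟩ := .of_step rfl

theorem Steps.seq {p q : Prog} (h : Steps N ⟨p :: q :: l, s⟩ κ) :
    Steps (N + 1) ⟨.seq p q :: l, s⟩ κ := .cons rfl h

theorem Steps.ite_true {e : Expr} {p q : Prog} (he : e.eval s ≠ 0) (h : Steps N ⟨p :: l, s⟩ κ) :
    Steps (N + 1) ⟨.ite e p q :: l, s⟩ κ := .cons (by simp [step, he]) h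

theorem Steps.ite_false {e : Expr} {p q : Prog} (he : e.eval s = 0) (h : Steps N ⟨q :: l, s⟩ κ) :
    Steps (N + 1) ⟨.ite e p q :: l, s⟩ κ := .cons (by simp [step, he]) h

theorem Steps.while_true {e : Expr} {p : Prog} (he : e.eval s ≠ 0)
    (h : Steps N ⟨p :: .while e p :: l, s⟩ κ) :
    Steps (N + 1) ⟨.while e p :: l, s⟩ κ := .cons (by simp [step, he]) h

theorem Steps.while_false {e : Expr} {p : Prog} (he : e.eval s = 0) :
    Steps 1 ⟨.while e p :: l, s⟩ ⟨l, s⟩ := .of_step (by simp [step, he])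

end Rules

/-! ### Halting probabilities -/

/-- The probability that the machine halts within `T` steps in a state in `H`. -/
noncomputable def haltProb (H : Set State) (T : ℕ) (κ : Config) : ℝ≥0∞ :=
  (runSteps T κ).toOuterMeasure {κ' | κ'.todo = [] ∧ κ'.state ∈ H}

theorem haltProb_add (H : Set State) (a T : ℕ) (κ : Config) :
    haltProb H (a + T) κ = ∑' κ', runSteps a κ κ' * haltProb H T κ' := by
  unfold haltProb
  rw [runSteps_add, PMF.toOuterMeasure_bind_apply]

theorem haltProb_nil (H : Set State) (T : ℕ) (s : State) [Decidable (s ∈ H)] :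
    haltProb H T ⟨[], s⟩ = if s ∈ H then 1 else 0 := by
  have h : runSteps T ⟨[], s⟩ = PMF.pure ⟨[], s⟩ := by
    induction T with
    | zero => rfl
    | succ T ih =>
      change (runSteps T _).bind step = _
      rw [ih, PMF.pure_bind]
      rfl
  classical
  unfold haltProb
  rw [h, PMF.toOuterMeasure_pure_apply]
  simp

theorem haltProb_zero_cons (H : Set State) (p : Prog) (l : List Prog) (s : State) :
    haltProb H 0 ⟨p :: l, s⟩ = 0 := by
  classical
  change (PMF.pure _).toOuterMeasure _ = 0
  rw [PMF.toOuterMeasure_pure_apply]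
  simp

/-- A halted configuration never changes, and one that has not halted contributes nothing at time
zero. -/
theorem haltProb_mono (H : Set State) (κ : Config) : Monotone fun T => haltProb H T κ := by
  refine monotone_nat_of_le_succ fun T => ?_
  classical
  rw [haltProb_add H T 1]
  conv_lhs => rw [← Nat.add_zero T, haltProb_add H T 0]
  refine ENNReal.tsum_le_tsum fun κ' => ?_
  gcongr
  obtain ⟨l, s⟩ := κ'
  cases l with
  | nil => rw [haltProb_nil, haltProb_nil]
  | cons p l => rw [haltProb_zero_cons]; exact zero_le

theorem Steps.haltProb_le {N : ℕ} {κ κ' : Config} (h : Steps N κ κ') (H : Set State) (T : ℕ) :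
    haltProb H T κ ≤ haltProb H T κ' := by
  obtain ⟨a, -, h⟩ := h
  refine (haltProb_mono H κ (Nat.le_add_left T a)).trans ?_
  change haltProb H (a + T) κ ≤ _
  unfold haltProb
  rw [runSteps_add, h, PMF.pure_bind]

theorem Steps.le_haltProb {N : ℕ} {κ κ' : Config} (h : Steps N κ κ') (H : Set State) (T : ℕ) :
    haltProb H T κ' ≤ haltProb H (T + N) κ := by
  obtain ⟨a, ha, h⟩ := h
  refine le_trans ?_ (haltProb_mono H κ (show a + T ≤ T + N by omega))
  change _ ≤ haltProb H (a + T) κ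
  unfold haltProb
  rw [runSteps_add, h, PMF.pure_bind]

/-- The machine goes from `κ` in at most `N` steps to a configuration `κ'` with `R a κ'`, where `a`
is distributed according to `μ`; this is expressed by bounds on the halting probabilities. -/
def Reaches {α : Type*} (N : ℕ) (κ : Config) (μ : PMF α) (R : α → Config → Prop) : Prop :=
  ∀ (H : Set State) (T : ℕ) (f : α → ℝ≥0∞),
    ((∀ a κ', R a κ' → f a ≤ haltProb H T κ') → ∑' a, μ a * f a ≤ haltProb H (T + N) κ) ∧
    ((∀ a κ', R a κ' → haltProb H T κ' ≤ f a) → haltProb H T κ ≤ ∑' a, μ a * f a)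

namespace Reaches

variable {α β : Type*} {M N : ℕ} {κ κ' : Config} {μ : PMF α} {R R' : α → Config → Prop}

theorem conseq (h : Reaches N κ μ R) (hR : ∀ a κ', R a κ' → R' a κ') : Reaches N κ μ R' :=
  fun H T f => ⟨fun hf => (h H T f).1 fun a κ' ha => hf a κ' (hR a κ' ha),
    fun hf => (h H T f).2 fun a κ' ha => hf a κ' (hR a κ' ha)⟩

theorem mono (h : Reaches M κ μ R) (hMN : M ≤ N) : Reaches N κ μ R :=
  fun H T f => ⟨fun hf => ((h H T f).1 hf).trans (haltProb_mono H κ (by omega)), (h H T f).2⟩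

theorem of_pure {a : α} (hR : R a κ) : Reaches 0 κ (PMF.pure a) R := by
  classical
  intro H T f
  have h : ∑' b, PMF.pure a b * f b = f a := by
    rw [tsum_eq_single a]
    · simp
    · intro b hb
      simp [hb]
  rw [h]
  exact ⟨fun hf => hf a κ hR, fun hf => hf a κ hR⟩

theorem of_steps (h : Steps N κ κ') (h' : Reaches M κ' μ R) : Reaches (N + M) κ μ R :=
  fun H T f => ⟨fun hf => ((h' H T f).1 hf).trans
      ((h.le_haltProb H (T + M)).trans (haltProb_mono H κ (by omega))),
    fun hf => (h.haltProb_le H T).trans ((h' H T f).2 hf)⟩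

/-- Branches may take different times, so there is no useful law of the configuration at a fixed
time. Because the test function `f` in `Reaches` is arbitrary, the bounds for the second phase can
serve as test function for the first, and the time bounds add up. -/
theorem bind {g : α → PMF β} {S : β → Config → Prop} (h : Reaches M κ μ R)
    (h' : ∀ a κ', R a κ' → Reaches N κ' (g a) S) : Reaches (M + N) κ (μ.bind g) S := by
  intro H T f
  have key : ∑' b, (μ.bind g) b * f b = ∑' a, μ a * ∑' b, g a b * f b := by
    simp_rw [PMF.bind_apply, ← ENNReal.tsum_mul_right, ← ENNReal.tsum_mul_left]
    rw [ENNReal.tsum_comm]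
    simp_rw [mul_assoc]
  rw [key]
  refine ⟨fun hf => ?_, fun hf => ?_⟩
  · have := (h H (T + N) _).1 fun a κ' ha => (h' a κ' ha H T f).1 hf
    rwa [add_assoc, add_comm N M] at this
  · exact (h H T _).2 fun a κ' ha => (h' a κ' ha H T f).2 hf

theorem rand (r k : ℕ) (l : List Prog) (s : State) :
    Reaches 1 ⟨.rand r k :: l, s⟩ (PMF.uniformOfFintype (Fin (k + 1)))
      (fun j κ' => κ' = ⟨l, s.setReg r j⟩) := by
  intro H T f
  have key : haltProb H (T + 1) ⟨.rand r k :: l, s⟩ =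
      ∑' j, PMF.uniformOfFintype (Fin (k + 1)) j * haltProb H T ⟨l, s.setReg r j⟩ := by
    rw [add_comm]
    unfold haltProb
    rw [runSteps_add, runSteps_one, step, PMF.bind_map]
    change (((PMF.uniformOfFintype (Fin (k + 1))).bind fun j => PMF.pure (j : ℕ)).bind
      _).toOuterMeasure _ = _
    rw [PMF.bind_bind, PMF.toOuterMeasure_bind_apply]
    simp_rw [PMF.pure_bind]
    rfl
  refine ⟨fun hf => ?_, fun hf => ?_⟩
  · rw [key]
    refine ENNReal.tsum_le_tsum fun j => ?_
    gcongr
    exact hf j _ rfl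
  · refine (haltProb_mono H _ (Nat.le_succ T)).trans ?_
    change haltProb H (T + 1) _ ≤ _
    rw [key]
    refine ENNReal.tsum_le_tsum fun j => ?_
    gcongr
    exact hf j _ rfl

end Reaches

/-! ### Expressions -/

namespace Expr

/-- The sum of a finite family of expressions. -/
noncomputable def fsum {ι : Type*} [Fintype ι] (f : ι → Expr) : Expr :=
  ((Finset.univ : Finset ι).toList.map f).foldr Expr.add (.lit 0)

theorem eval_fsum {ι : Type*} [Fintype ι] (f : ι → Expr) (s : State) :
    (fsum f).eval s = ∑ i, (f i).eval s := by
  have h : ∀ l : List ι, ((l.map f).foldr Expr.add (.lit 0)).eval s =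
      (l.map fun i => (f i).eval s).sum := by
    intro l
    induction l with
    | nil => rfl
    | cons a l ih => simp [Expr.eval, ih]
  rw [fsum, h, Finset.sum_map_toList]

/-- The product of a constant and an expression. -/
noncomputable def scale (k : ℕ) (e : Expr) : Expr := fsum fun _ : Fin k => e

theorem eval_scale (k : ℕ) (e : Expr) (s : State) : (scale k e).eval s = k * e.eval s := by
  simp [scale, eval_fsum]

/-- `e i = k i` for all `i`. -/
noncomputable def allEq {ι : Type*} [Fintype ι] (e : ι → Expr) (k : ι → ℕ) : Expr :=
  .eq (fsum fun i => .eq (e i) (.lit (k i))) (.lit (Fintype.card ι))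

theorem eval_allEq {ι : Type*} [Fintype ι] (e : ι → Expr) (k : ι → ℕ) (s : State)
    [Decidable (∀ i, (e i).eval s = k i)] :
    (allEq e k).eval s = if ∀ i, (e i).eval s = k i then 1 else 0 := by
  have h : (∑ i, if (e i).eval s = k i then 1 else 0) = Fintype.card ι ↔
      ∀ i, (e i).eval s = k i := by
    rw [← Finset.card_filter, ← Finset.card_univ, Finset.card_filter_eq_iff]
    simp
  simp only [allEq, Expr.eval, eval_fsum]
  exact if_congr h rfl rfl

/-- The value of `f`, provided that it is at most `k` and `e` is nonzero, and `0` otherwise. -/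
noncomputable def guarded (e f : Expr) (k : ℕ) : Expr :=
  .sub f (scale k (.eq e (.lit 0)))

/-- Truncated subtraction of `k` erases any value up to `k`, which replaces a multiplication by the
guard. -/
theorem eval_guarded {e f : Expr} {k : ℕ} {s : State} (h : f.eval s ≤ k) :
    (guarded e f k).eval s = if e.eval s ≠ 0 then f.eval s else 0 := by
  by_cases he : e.eval s = 0 <;> simp [guarded, Expr.eval, eval_scale, he, h]

end Expr

/-! ### Local decoding by tables, and exact sampling of one bit. -/

section LocalTables

variable {n m c d : ℕ} {G : BipGraph n m}

/-- The machine holds the word `x` and the adjacency lists `A`. -/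
structure Holds (A : AdjLists G c d) (x : Fin n → ZMod 2) (s : State) : Prop where
  word : ∀ u : Fin n, s.arr .word u = (x u).val
  right : ∀ (v : Fin m) (i : Fin d), s.arr (.rightNbr i) v = ((A.right v i : Fin n) : ℕ)
  left : ∀ (u : Fin n) (j : Fin c), s.arr (.leftNbr j) u = ((A.left u j : Fin m) : ℕ)

/-- The value of the function `F` at the local view of the check given by `e`. -/
noncomputable def tableExpr (F : (Fin d → ZMod 2) → ℕ) (e : Expr) : Expr :=
  .fsum fun w : Fin d → ZMod 2 =>
    .scale (F w) (.allEq (fun i : Fin d => .get .word (.get (.rightNbr i) e)) fun i => (w i).val)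

/-- Only the summand of the actual local view passes the equality test. The table ranges over all
words of length `d`, hence has constant size. -/
theorem eval_tableExpr {A : AdjLists G c d} {x : Fin n → ZMod 2} {s : State} (hs : Holds A x s)
    (F : (Fin d → ZMod 2) → ℕ) {e : Expr} {v : Fin m} (he : e.eval s = v) :
    (tableExpr F e).eval s = F (localView A x v) := by
  classical
  have h : ∀ w : Fin d → ZMod 2,
      (∀ i : Fin d, (Expr.get .word (.get (.rightNbr i) e)).eval s = (w i).val) ↔
        w = localView A x v := by
    intro w
    simp only [Expr.eval, he, hs.right, hs.word, funext_iff]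
    exact forall_congr' fun i => ⟨fun h => (ZMod.val_injective 2 h).symm, fun h => by
      rw [h]; rfl⟩
  simp [tableExpr, Expr.eval_fsum, Expr.eval_scale, Expr.eval_allEq, h]

variable (C : Submodule (ZMod 2) (Fin d → ZMod 2))

open Classical in
/-- The numerator, for the denominator `c * d₀`, of the vote of a check with local view `w` for its
`i`-th neighbour. -/
noncomputable def voteNum (i : Fin d) (w : Fin d → ZMod 2) : ℕ :=
  if decode C w i ≠ w i ∧ ∀ j < i, decode C w j = w j then
    minDist C - 2 * hammingDist (decode C w) w else 0

theorem voteNum_le (i : Fin d) (w : Fin d → ZMod 2) : voteNum C i w ≤ minDist C := by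
  unfold voteNum
  split_ifs <;> omega

/-- Both conditions on the local distance are absorbed by `voteNum`: a differing coordinate forces
distance at least `1`, and truncated subtraction gives `0` from distance `d₀/2` on. Doubling
numerator and denominator makes everything integral. -/
theorem vote_eq (A : AdjLists G c d) (x : Fin n → ZMod 2) (v : Fin m) (u : Fin n) :
    vote A C x v u =
      ((∑ i, if (A.right v i : Fin n) = u then voteNum C i (localView A x v) else 0 : ℕ) : ℝ) /
        (c * minDist C) := by
  classical
  by_cases hu : IsFirstDiff A C x v u
  · obtain ⟨i, hi, hne, hlt⟩ := id hu
    have hpos : 1 ≤ localDist A C x v := by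
      rw [Nat.one_le_iff_ne_zero]
      intro h
      exact hne (congrFun (hammingDist_eq_zero.1 h) i)
    have hsum : (∑ i, if (A.right v i : Fin n) = u then voteNum C i (localView A x v) else 0) =
        minDist C - 2 * localDist A C x v := by
      rw [Finset.sum_eq_single i]
      · rw [if_pos hi, voteNum, if_pos ⟨hne, hlt⟩, localDist]
      · intro j _ hj
        rw [if_neg]
        rintro rfl
        exact hj ((A.right v).injective (Subtype.ext hi)).symm
      · simp
    rw [hsum]
    unfold vote
    dsimp only
    by_cases ht : (localDist A C x v : ℝ) < (minDist C : ℝ) / 2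
    · have h2 : 2 * localDist A C x v ≤ minDist C := by
        have : (2 * localDist A C x v : ℝ) ≤ minDist C := by linarith
        exact_mod_cast this
      rw [if_pos ⟨hpos, ht, hu⟩, Nat.cast_sub h2]
      push_cast
      rw [← mul_div_mul_left _ (c * ((minDist C : ℝ) / 2)) two_ne_zero]
      congr 1 <;> ring
    · have h2 : minDist C ≤ 2 * localDist A C x v := by
        have : (minDist C : ℝ) ≤ 2 * localDist A C x v := by linarith
        exact_mod_cast this
      rw [if_neg fun h => ht h.2.1, Nat.sub_eq_zero_of_le h2]
      simp
  · have hsum : (∑ i, if (A.right v i : Fin n) = u then voteNum C i (localView A x v) else 0) =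
        0 := by
      refine Finset.sum_eq_zero fun i _ => ?_
      by_cases hi : (A.right v i : Fin n) = u
      · rw [if_pos hi, voteNum, if_neg fun h => hu ⟨i, hi, h⟩]
      · rw [if_neg hi]
    rw [hsum, vote]
    simp [hu]

/-- The numerator, for the denominator `c * d₀`, of the flipping probability of `u`. -/
noncomputable def flipNum (A : AdjLists G c d) (x : Fin n → ZMod 2) (u : Fin n) : ℕ :=
  ∑ j, ∑ i, if (A.right (A.left u j) i : Fin n) = u then
    voteNum C i (localView A x (A.left u j)) else 0

theorem flipProb_eq (A : AdjLists G c d) (x : Fin n → ZMod 2) (u : Fin n) :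
    flipProb A C x u = flipNum C A x u / (c * minDist C) := by
  classical
  have h1 : flipProb A C x u = ∑ j, vote A C x (A.left u j) u := by
    rw [(A.left u).sum_comp fun v => vote A C x v u]
    unfold flipProb
    rw [← Finset.sum_subtype (Finset.univ.filter fun v => G.Adj u v) (by simp)
      fun v => vote A C x v u, Finset.sum_filter_of_ne]
    intro v _ hv
    by_contra hn
    exact hv (vote_eq_zero A C x v u hn)
  rw [h1, flipNum, Nat.cast_sum, Finset.sum_div]
  exact Finset.sum_congr rfl fun j _ => vote_eq C A x _ u

/-- The numerator of the flipping probability of the vertex given by `e`. -/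
noncomputable def flipExpr (c : ℕ) (e : Expr) : Expr :=
  .fsum fun j : Fin c => .fsum fun i : Fin d =>
    .guarded (.eq (.get (.rightNbr i) (.get (.leftNbr j) e)) e)
      (tableExpr (voteNum C i) (.get (.leftNbr j) e)) (minDist C)

theorem eval_flipExpr {A : AdjLists G c d} {x : Fin n → ZMod 2} {s : State} (hs : Holds A x s)
    {e : Expr} {u : Fin n} (he : e.eval s = u) :
    (flipExpr C c e).eval s = flipNum C A x u := by
  simp only [flipExpr, Expr.eval_fsum, flipNum]
  refine Finset.sum_congr rfl fun j _ => Finset.sum_congr rfl fun i _ => ?_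
  have hv : (Expr.get (.leftNbr j) e).eval s = ((A.left u j : Fin m) : ℕ) := by
    simp only [Expr.eval, he, hs.left]
  have ht := eval_tableExpr hs (voteNum C i) hv
  rw [Expr.eval_guarded (ht.trans_le (voteNum_le C i _)), ht]
  simp only [Expr.eval, he, hs.left, hs.right]
  simp [Fin.ext_iff]

/-- The distribution of the `u`-th bit of the result of `RandFlip(x)`. -/
noncomputable def bitPMF (A : AdjLists G c d) (x : Fin n → ZMod 2) (u : Fin n) : PMF (ZMod 2) :=
  PMF.ofFintype (bitProb A C x u) (sum_bitProb A C x u)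

theorem map_uniform_eq_bitPMF (hc : 0 < c) (A : AdjLists G c d) (x : Fin n → ZMod 2) (u : Fin n) :
    (PMF.uniformOfFintype (Fin (c * minDist C - 1 + 1))).map
      (fun j : Fin _ => if (j : ℕ) < flipNum C A x u then x u + 1 else x u) = bitPMF C A x u := by
  classical
  set k := c * minDist C - 1 with hk
  set N := flipNum C A x u with hN
  have hp : flipProb A C x u = N / ((k + 1 : ℕ) : ℝ) ∧ N ≤ k + 1 := by
    -- For `d₀ = 0` the draw is from a one-element set and all votes vanish, in agreement with
    -- division by zero in `flipProb_eq`.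
    rcases Nat.eq_zero_or_pos (minDist C) with h0 | h0
    · have : N = 0 := by
        refine Finset.sum_eq_zero fun j _ => Finset.sum_eq_zero fun i _ => ?_
        have := voteNum_le C i (localView A x (A.left u j))
        split_ifs <;> omega
      rw [flipProb_eq, ← hN, this]
      simp
    · have hk1 : k + 1 = c * minDist C := Nat.sub_add_cancel (Nat.mul_pos hc h0)
      have hpos : (0 : ℝ) < ((k + 1 : ℕ) : ℝ) := by positivity
      have h : flipProb A C x u = N / ((k + 1 : ℕ) : ℝ) := by
        rw [flipProb_eq, hk1]
        push_cast
        rfl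
      refine ⟨h, ?_⟩
      have := flipProb_le_one A C x u
      rw [h, div_le_one hpos] at this
      exact_mod_cast this
  obtain ⟨hp, hle⟩ := hp
  have hcard : ∀ (P : Fin (k + 1) → Prop) [DecidablePred P] (q : ℝ), 0 ≤ q →
      (Finset.univ.filter P).card = q * (k + 1) →
      ∑ j, (if P j then PMF.uniformOfFintype (Fin (k + 1)) j else 0) = ENNReal.ofReal q := by
    intro P _ q hq h
    simp only [PMF.uniformOfFintype_apply, Fintype.card_fin]
    rw [← Finset.sum_filter, Finset.sum_const, nsmul_eq_mul, ← div_eq_mul_inv,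
      ← ENNReal.ofReal_natCast, h, ← ENNReal.ofReal_natCast, ← ENNReal.ofReal_div_of_pos]
    · congr 1
      push_cast
      field_simp
    · positivity
  have hlt : (Finset.univ.filter fun j : Fin (k + 1) => (j : ℕ) < N).card = N := by
    rw [Fin.card_filter_val_lt]
    omega
  have hnlt : (Finset.univ.filter fun j : Fin (k + 1) => ¬ (j : ℕ) < N).card = k + 1 - N := by
    have := Finset.card_filter_add_card_filter_not (s := (Finset.univ : Finset (Fin (k + 1))))
      fun j => (j : ℕ) < N
    rw [hlt, Finset.card_univ, Fintype.card_fin] at this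
    omega
  have hk0 : ((k : ℝ) + 1) ≠ 0 := by positivity
  have hx : x u ≠ x u + 1 := by simp
  ext b
  rw [PMF.map_apply, tsum_fintype, bitPMF, PMF.ofFintype_apply, bitProb]
  split_ifs with hb
  · rw [← hcard (fun j : Fin (k + 1) => ¬ (j : ℕ) < N) _ (sub_nonneg.2 (flipProb_le_one A C x u))]
    · refine Finset.sum_congr rfl fun j _ => ?_
      by_cases hj : (j : ℕ) < N <;> simp [hj, hb]
    · rw [hnlt, hp, Nat.cast_sub hle]
      push_cast
      field_simp
  · have hb' : b = x u + 1 := by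
      have : ∀ a b : ZMod 2, ¬ b = a → b = a + 1 := by decide
      exact this _ _ hb
    rw [← hcard (fun j : Fin (k + 1) => (j : ℕ) < N) _ (flipProb_nonneg A C x u)]
    · refine Finset.sum_congr rfl fun j _ => ?_
      by_cases hj : (j : ℕ) < N <;> simp [hj, hb']
    · rw [hlt, hp]
      push_cast
      field_simp

end LocalTables

/-! ### The program -/

@[simp] theorem State.reg_setReg (s : State) (r k q : ℕ) :
    (s.setReg r k).reg q = if q = r then k else s.reg q := by
  simp [State.setReg, Function.update_apply]

@[simp] theorem State.arr_setReg (s : State) (r k : ℕ) : (s.setReg r k).arr = s.arr := rfl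

@[simp] theorem State.reg_setArr (s : State) (a : Arr) (i k : ℕ) :
    (s.setArr a i k).reg = s.reg := rfl

theorem State.arr_setArr_of_ne (s : State) {a b : Arr} (i k : ℕ) (h : b ≠ a) :
    (s.setArr a i k).arr b = s.arr b := by
  simp [State.setArr, h]

theorem State.arr_setArr_self (s : State) (a : Arr) (i k j : ℕ) :
    (s.setArr a i k).arr a j = if j = i then k else s.arr a j := by
  simp [State.setArr, Function.update_apply]

theorem Expr.eval_get (a : Arr) (e : Expr) (s : State) :
    (Expr.get a e).eval s = s.arr a (e.eval s) := rfl

theorem Expr.eval_lt_eq_zero (e f : Expr) (s : State) :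
    (Expr.lt e f).eval s = 0 ↔ ¬ e.eval s < f.eval s := by
  simp [Expr.eval]

/-- The current entry of the queue. -/
def cur : Expr := .get (.work 0) (.reg 4)

/-- Execute `p` for all further values of register `4` below the content of register `b`. -/
def forLoop (b : ℕ) (p : Prog) : Prog :=
  .while (.lt (.reg 4) (.reg b)) (.seq p (.assign 4 (.add (.reg 4) (.lit 1))))

/-- Draw the new bit of the current vertex. -/
noncomputable def drawBit {d : ℕ} (c : ℕ) (C : Submodule (ZMod 2) (Fin d → ZMod 2)) : Prog :=
  .seq (.rand 5 (c * minDist C - 1))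
    (.store (.work 1) cur
      (.eq (.lt (.reg 5) (flipExpr C c cur)) (.eq (.get .word cur) (.lit 0))))

/-- Replace the bit of the current vertex by the bit drawn for it. -/
def commitBit : Prog := .store .word cur (.get (.work 1) cur)

open Classical in
/-- If the `j`-th check of the current vertex is unsatisfied, append its `i`-th neighbour to the
queue, unless this vertex has been appended before. -/
noncomputable def pushNbr {d : ℕ} (C : Submodule (ZMod 2) (Fin d → ZMod 2)) (j i : ℕ) : Prog :=
  .ite (tableExpr (fun w => if w ∉ C then 1 else 0) (.get (.leftNbr j) cur))
    (.ite (.lt (.reg 3) (.get (.work 2) (.get (.rightNbr i) (.get (.leftNbr j) cur))))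
      .skip
      (.seq (.store (.work 0) (.reg 6) (.get (.rightNbr i) (.get (.leftNbr j) cur)))
        (.seq (.assign 6 (.add (.reg 6) (.lit 1)))
          (.store (.work 2) (.get (.rightNbr i) (.get (.leftNbr j) cur)) (.reg 6)))))
    .skip

/-- Execute `pushNbr` for all the given pairs of indices. -/
noncomputable def pushNbrs {c d : ℕ} (C : Submodule (ZMod 2) (Fin d → ZMod 2))
    (l : List (Fin c × Fin d)) : Prog :=
  l.foldr (fun p q => .seq (pushNbr C p.1 p.2) q) .skip

/-- Replace the queue by the list of the neighbours of the unsatisfied checks of its entries. -/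
noncomputable def collect {d : ℕ} (c : ℕ) (C : Submodule (ZMod 2) (Fin d → ZMod 2)) : Prog :=
  .seq (.assign 6 (.reg 3)) (.seq (.assign 4 (.reg 2))
    (.seq (forLoop 3 (pushNbrs C (Finset.univ : Finset (Fin c × Fin d)).toList))
      (.seq (.assign 2 (.reg 3)) (.assign 3 (.reg 6)))))

/-- One execution of `RandFlip`. -/
noncomputable def flipRound {d : ℕ} (c : ℕ) (C : Submodule (ZMod 2) (Fin d → ZMod 2)) : Prog :=
  .seq (.assign 4 (.reg 2)) (.seq (forLoop 3 (drawBit c C))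
    (.seq (.assign 4 (.reg 2)) (.seq (forLoop 3 commitBit) (collect c C))))

/-- The main loop. -/
noncomputable def mainLoop {d : ℕ} (c : ℕ) (C : Submodule (ZMod 2) (Fin d → ZMod 2)) : Prog :=
  .while (.lt (.reg 2) (.reg 3)) (flipRound c C)

/-- The implementation of `RandDecode`. -/
noncomputable def decoder {d : ℕ} (c : ℕ) (C : Submodule (ZMod 2) (Fin d → ZMod 2)) : Prog :=
  .seq (forLoop 0 (.store (.work 0) (.reg 4) (.reg 4))) (.seq (.assign 3 (.reg 0))
    (.seq (collect c C) (mainLoop c C)))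

/-! ### The phases of a round: drawing, committing, collecting. -/

section Correctness

variable {n m c d : ℕ} {G : BipGraph n m} {A : AdjLists G c d}
  {C : Submodule (ZMod 2) (Fin d → ZMod 2)} {x : Fin n → ZMod 2} {s s' : State} {l : List Prog}

theorem Holds.congr {x' : Fin n → ZMod 2} (h : Holds A x s)
    (hw : ∀ u : Fin n, s'.arr .word u = (x' u).val)
    (hr : ∀ i, s'.arr (.rightNbr i) = s.arr (.rightNbr i))
    (hl : ∀ j, s'.arr (.leftNbr j) = s.arr (.leftNbr j)) : Holds A x' s' :=
  ⟨hw, fun v i => by rw [hr, h.right], fun u j => by rw [hl, h.left]⟩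

/-- The list `us` is stored in the queue from position `a` on. -/
def Queued (s : State) (a : ℕ) (us : List (Fin n)) : Prop :=
  ∀ (k : ℕ) (h : k < us.length), s.arr (.work 0) (a + k) = us[k]

theorem Queued.head {a : ℕ} {u : Fin n} {us : List (Fin n)} (h : Queued s a (u :: us)) :
    s.arr (.work 0) a = u := h 0 (by simp)

theorem Queued.tail {a : ℕ} {u : Fin n} {us : List (Fin n)} (h : Queued s a (u :: us)) :
    Queued s (a + 1) us := by
  intro k hk
  have := h (k + 1) (by simpa using hk)
  rw [← add_assoc, add_right_comm] at this
  simpa using this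

theorem Queued.congr {a : ℕ} {us : List (Fin n)} (h : Queued s a us)
    (h' : s'.arr (.work 0) = s.arr (.work 0)) : Queued s' a us := by
  unfold Queued
  rwa [h']

@[simp] theorem queued_setReg {a r k : ℕ} {us : List (Fin n)} :
    Queued (s.setReg r k) a us ↔ Queued s a us := Iff.rfl

theorem Queued.setArr {a i k : ℕ} {us : List (Fin n)} (h : Queued s a us)
    (hi : a + us.length ≤ i) : Queued (s.setArr (.work 0) i k) a us := by
  intro q hq
  rw [State.arr_setArr_self, if_neg (by omega), h q hq]

theorem Queued.append {a i k : ℕ} {us : List (Fin n)} {u : Fin n} (h : Queued s a us)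
    (hi : i = a + us.length) (hk : k = u) :
    Queued (s.setArr (.work 0) i k) a (us ++ [u]) := by
  intro q hq
  rw [State.arr_setArr_self]
  rcases Nat.lt_or_ge q us.length with hlt | hge
  · rw [if_neg (by omega), h q hlt, List.getElem_append_left hlt]
  · have : q = us.length := by
      rw [List.length_append, List.length_singleton] at hq
      omega
    subst this
    rw [if_pos hi.symm]
    simpa using hk

variable (A C x) in
/-- The result of redrawing successively the bits at the positions in a list. -/
noncomputable def drawPMF : List (Fin n) → (Fin n → ZMod 2) → PMF (Fin n → ZMod 2)
  | [], z => PMF.pure z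
  | u :: us, z => (bitPMF C A x u).bind fun b => drawPMF us (Function.update z u b)

/-- Without repetitions no position is redrawn, so the successive draws give a product law. -/
theorem drawPMF_apply (us : List (Fin n)) (hus : us.Nodup) (z w : Fin n → ZMod 2) :
    drawPMF A C x us z w =
      ∏ u, if u ∈ us then bitProb A C x u (w u) else if w u = z u then 1 else 0 := by
  induction us generalizing z with
  | nil =>
    simp only [drawPMF, PMF.pure_apply, List.not_mem_nil, if_false]
    split_ifs with h
    · simp [h]
    · obtain ⟨u, hu⟩ := Function.ne_iff.1 h
      exact (Finset.prod_eq_zero (Finset.mem_univ u) (if_neg hu)).symm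
  | cons a us ih =>
    obtain ⟨ha, hus⟩ := List.nodup_cons.1 hus
    rw [drawPMF, PMF.bind_apply, tsum_eq_single (w a)]
    · rw [ih hus, ← Finset.mul_prod_erase _ _ (Finset.mem_univ a),
        ← Finset.mul_prod_erase _ _ (Finset.mem_univ a)]
      simp only [ha, Function.update_self, if_false, if_true, one_mul, List.mem_cons, true_or]
      congr 1
      refine Finset.prod_congr rfl fun u hu => ?_
      have hne := Finset.ne_of_mem_erase hu
      simp [hne]
    · intro b hb
      rw [ih hus, Finset.prod_eq_zero (Finset.mem_univ a), mul_zero]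
      simp [ha, Ne.symm hb]

/-- Leaving alone a bit whose flipping probability is `0` does not change the law; hence drawing
only the queued bits is enough. -/
theorem drawPMF_eq_randFlip {us : List (Fin n)} (hus : us.Nodup)
    (h : ∀ u, u ∉ us → flipProb A C x u = 0) : drawPMF A C x us x = randFlip A C x := by
  ext w
  rw [drawPMF_apply us hus, randFlip, PMF.ofFintype_apply]
  refine Finset.prod_congr rfl fun u _ => ?_
  split_ifs with hu hw
  · rfl
  · simp [bitProb, hw, h u hu]
  · simp [bitProb, hw, h u hu]

/-- The exclusive or of a bit and a flip, written with equality tests only, as `drawBit` computes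
it. -/
theorem zmod_two_flip (a : ZMod 2) (p : Prop) [Decidable p] :
    (if (if p then 1 else 0) = (if a.val = 0 then 1 else 0 : ℕ) then 1 else 0 : ℕ) =
      (if p then a + 1 else a).val := by
  by_cases hp : p <;> simp only [hp, if_true, if_false] <;> revert a <;> decide

/-- New bits go to `work 1` while `word` still holds `x`, so every draw uses the flipping
probabilities of `x`. The set `D` generalizes the induction: it records the positions drawn already.
-/
theorem draw_reaches (hc : 0 < c) (us : List (Fin n)) (z : Fin n → ZMod 2) (D : Set (Fin n))
    (hs : Holds A x s) (hq : Queued s (s.reg 4) us) (h3 : s.reg 3 = s.reg 4 + us.length)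
    (hD : ∀ u ∈ D, s.arr (.work 1) u = (z u).val) :
    Reaches (6 * us.length + 1) ⟨forLoop 3 (drawBit c C) :: l, s⟩ (drawPMF A C x us z)
      fun z' κ => (∀ u, u ∉ us → z' u = z u) ∧ ∃ s', κ = ⟨l, s'⟩ ∧
        (∀ a, a ≠ .work 1 → s'.arr a = s.arr a) ∧
        (∀ r, r ≠ 4 → r ≠ 5 → s'.reg r = s.reg r) ∧
        ∀ u, u ∈ D ∨ u ∈ us → s'.arr (.work 1) u = (z' u).val := by
  induction us generalizing s z D with
  | nil =>
    refine (Reaches.of_steps (Steps.while_false ?_) (Reaches.of_pure ⟨fun _ _ => rfl, s, rfl,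
      fun _ _ => rfl, fun _ _ _ => rfl, ?_⟩)).mono (by simp)
    · simp only [List.length_nil, add_zero] at h3
      simp [Expr.eval, h3]
    · simpa using hD
  | cons u us ih =>
    rw [List.length_cons] at h3
    rw [drawPMF, ← map_uniform_eq_bitPMF C hc A x u, PMF.bind_map]
    have h0 : Steps 3 ⟨forLoop 3 (drawBit c C) :: l, s⟩ _ :=
      Steps.while_true (by simp [Expr.eval, h3]) (Steps.seq (Steps.seq (Steps.refl _)))
    refine (Reaches.of_steps h0 ((Reaches.rand _ _ _ _).bind
      (N := 2 + (6 * us.length + 1)) ?_)).mono (by rw [List.length_cons]; omega)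
    rintro j _ rfl
    refine Reaches.of_steps (Steps.store.trans Steps.assign) ?_
    have hs1 : Holds A x (s.setReg 5 j) := hs.congr hs.word (fun _ => rfl) fun _ => rfl
    have hcur : cur.eval (s.setReg 5 j) = u := by simp [cur, Expr.eval, hq.head]
    have hbit : (Expr.eq (.lt (.reg 5) (flipExpr C c cur)) (.eq (.get .word cur) (.lit 0))).eval
        (s.setReg 5 j) = (if (j : ℕ) < flipNum C A x u then x u + 1 else x u).val := by
      rw [← zmod_two_flip]
      simp only [Expr.eval, eval_flipExpr C hs1 hcur, hcur, hs1.word]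
      simp
    rw [hcur, hbit]
    set b := if (j : ℕ) < flipNum C A x u then x u + 1 else x u with hb
    have hne : ∀ a, a ≠ .work 1 → (((s.setReg 5 j).setArr (.work 1) u b.val).setReg 4
        ((Expr.add (.reg 4) (.lit 1)).eval ((s.setReg 5 j).setArr (.work 1) u b.val))).arr a =
          s.arr a := fun a ha => by
      rw [State.arr_setReg, State.arr_setArr_of_ne _ _ _ ha, State.arr_setReg]
    refine (ih (Function.update z u b) (insert u D) ?_ ?_ ?_ ?_).conseq ?_
    · exact hs.congr (fun u => by rw [hne _ (by simp), hs.word]) (fun _ => hne _ (by simp))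
        fun _ => hne _ (by simp)
    · have := hq.tail.congr (hne (.work 0) (by simp))
      simpa [Expr.eval] using this
    · simp [Expr.eval, h3]
      omega
    · intro w hw
      rw [State.arr_setReg, State.arr_setArr_self, State.arr_setReg]
      by_cases hwu : w = u
      · simp [hwu]
      · rw [if_neg (Fin.val_ne_of_ne hwu), Function.update_of_ne hwu]
        exact hD w (hw.resolve_left hwu)
    · rintro z' κ ⟨h1, s', rfl, h2, h3', h4⟩
      refine ⟨fun w hw => ?_, s', rfl, fun a ha => (h2 a ha).trans (hne a ha), fun r hr hr5 => ?_,
        fun w hw => h4 w ?_⟩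
      · rw [List.mem_cons, not_or] at hw
        rw [h1 w hw.2, Function.update_of_ne hw.1]
      · rw [h3' r hr hr5]
        simp [hr, hr5]
      · rw [List.mem_cons] at hw
        rw [Set.mem_insert_iff]
        tauto

theorem commit_steps (us : List (Fin n)) (hq : Queued s (s.reg 4) us)
    (h3 : s.reg 3 = s.reg 4 + us.length) :
    ∃ s', Steps (4 * us.length + 1) ⟨forLoop 3 commitBit :: l, s⟩ ⟨l, s'⟩ ∧
      (∀ a, a ≠ .word → s'.arr a = s.arr a) ∧ (∀ r, r ≠ 4 → s'.reg r = s.reg r) ∧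
      ∀ u : Fin n, s'.arr .word u = if u ∈ us then s.arr (.work 1) u else s.arr .word u := by
  induction us generalizing s with
  | nil =>
    refine ⟨s, (Steps.while_false ?_).mono (by simp), fun _ _ => rfl, fun _ _ => rfl, by simp⟩
    simp only [List.length_nil, add_zero] at h3
    simp [Expr.eval, h3]
  | cons u us ih =>
    rw [List.length_cons] at h3
    have h0 : Steps 4 ⟨forLoop 3 commitBit :: l, s⟩ ⟨forLoop 3 commitBit :: l,
        (s.setArr .word u (s.arr (.work 1) u)).setReg 4 (s.reg 4 + 1)⟩ := by
      refine Steps.while_true (by simp [Expr.eval, h3]) (Steps.seq ?_)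
      have hcur : cur.eval s = u := by simp [cur, Expr.eval, hq.head]
      have := Steps.store (l := .assign 4 (.add (.reg 4) (.lit 1)) :: forLoop 3 commitBit :: l)
        (s := s) (a := .word) (e := cur) (f := .get (.work 1) cur)
      simp only [Expr.eval, hcur] at this
      exact this.trans Steps.assign
    have hne : ∀ a, a ≠ .word → ((s.setArr .word u (s.arr (.work 1) u)).setReg 4
        (s.reg 4 + 1)).arr a = s.arr a := fun a ha => by
      rw [State.arr_setReg, State.arr_setArr_of_ne _ _ _ ha]
    obtain ⟨s', h1, h2, h4, h5⟩ := ih (s := (s.setArr .word u (s.arr (.work 1) u)).setReg 4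
      (s.reg 4 + 1)) (by simpa using hq.tail.congr (hne (.work 0) (by simp)))
      (by simp; omega)
    refine ⟨s', (h0.trans h1).mono (by rw [List.length_cons]; omega),
      fun a ha => (h2 a ha).trans (hne a ha), fun r hr => ?_, fun w => ?_⟩
    · rw [h4 r hr]
      simp [hr]
    · rw [h5, hne (.work 1) (by simp), State.arr_setReg, State.arr_setArr_self]
      by_cases hwu : w = u
      · simp [hwu]
      · simp [hwu, Fin.val_inj]

variable (A x) in
/-- The state of the machine while the new queue is built: `us` lists the entries of the old queue
from the current one on, and `L` those of the new queue, which starts at position `h`. -/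
structure Collecting (h : ℕ) (us L : List (Fin n)) (s : State) : Prop where
  holds : Holds A x s
  old : Queued s (s.reg 4) us
  reg_three : s.reg 3 = h
  old_end : h = s.reg 4 + us.length
  new : Queued s h L
  nodup : L.Nodup
  reg_six : s.reg 6 = h + L.length
  mark : ∀ u : Fin n, h < s.arr (.work 2) u ↔ u ∈ L
  mark_le : ∀ u : Fin n, s.arr (.work 2) u ≤ h + L.length

/-- A vertex is marked with one plus its position in the queue. Positions only grow over the whole
run, so marks above the start `h` of the new queue belong exactly to its members, and older marks,
being at most `h`, need no resetting. -/
theorem pushNbr_steps {h : ℕ} {u : Fin n} {us L : List (Fin n)}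
    (hs : Collecting A x h (u :: us) L s) (j : Fin c) (i : Fin d) :
    ∃ s' L', Steps 7 ⟨pushNbr C j i :: l, s⟩ ⟨l, s'⟩ ∧ Collecting A x h (u :: us) L' s' ∧
      ∀ w, w ∈ L' ↔ w ∈ L ∨ ((A.left u j : Fin m) ∈ unsat A C x ∧
        w = A.right (A.left u j) i) := by
  classical
  set v : Fin m := (A.left u j : Fin m) with hv
  set w : Fin n := (A.right v i : Fin n) with hw
  have hv' : ∀ t : State, t.arr (.work 0) (t.reg 4) = u →
      (∀ j, t.arr (.leftNbr j) = s.arr (.leftNbr j)) →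
      (Expr.get (.leftNbr j) cur).eval t = v := fun t ht hl => by
    simp only [cur, Expr.eval, ht, hl, hs.holds.left]
    rfl
  have hw' : ∀ t : State, t.arr (.work 0) (t.reg 4) = u →
      (∀ j, t.arr (.leftNbr j) = s.arr (.leftNbr j)) →
      (∀ i, t.arr (.rightNbr i) = s.arr (.rightNbr i)) →
      (Expr.get (.rightNbr i) (.get (.leftNbr j) cur)).eval t = w := fun t ht hl hr => by
    rw [Expr.eval, hv' t ht hl, hr, hs.holds.right]
  have hvs := hv' s hs.old.head fun _ => rfl
  have hws := hw' s hs.old.head (fun _ => rfl) fun _ => rfl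
  have htab := eval_tableExpr hs.holds (fun w => if w ∉ C then 1 else 0) hvs
  by_cases hun : v ∈ unsat A C x
  · have hun' : localView A x v ∉ C := hun
    rw [if_pos hun'] at htab
    by_cases hmem : w ∈ L
    · refine ⟨s, L, (Steps.ite_true (by rw [htab]; simp) (Steps.ite_true ?_ Steps.skip)).mono
        (by norm_num), hs, fun w' => ?_⟩
      · rw [Ne, Expr.eval_lt_eq_zero, Expr.eval_get, hws, not_not]
        exact hs.reg_three.trans_lt ((hs.mark w).2 hmem)
      · constructor
        · exact Or.inl
        · rintro (h | ⟨-, rfl⟩)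
          exacts [h, hmem]
    · set s1 := s.setArr (.work 0) (s.reg 6) w with hs1
      set s2 := s1.setReg 6 (s.reg 6 + 1) with hs2
      set s3 := s2.setArr (.work 2) w (s.reg 6 + 1) with hs3
      have hlen := hs.old_end
      have h6 := hs.reg_six
      rw [List.length_cons] at hlen
      -- The new entry is written beyond the old queue, so the index expressions, which are
      -- evaluated again later, keep their values.
      have hhead : s2.arr (.work 0) (s2.reg 4) = u := by
        have : s1.arr (.work 0) (s.reg 4) = u :=
          (hs.old.setArr (by rw [List.length_cons]; omega)).head
        simpa [hs2, hs1] using this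
      have hne : ∀ a, a ≠ .work 0 → a ≠ .work 2 → s3.arr a = s.arr a := fun a h0 h2 => by
        rw [hs3, State.arr_setArr_of_ne _ _ _ h2, hs2, State.arr_setReg, hs1,
          State.arr_setArr_of_ne _ _ _ h0]
      have h30 : s3.arr (.work 0) = s1.arr (.work 0) := by
        rw [hs3, State.arr_setArr_of_ne _ _ _ (by simp), hs2, State.arr_setReg]
      have hreg : ∀ r, r ≠ 6 → s3.reg r = s.reg r := fun r hr => by
        simp [hs3, hs2, hs1, hr]
      refine ⟨s3, L ++ [w], ?_, ?_, ?_⟩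
      · refine Steps.ite_true (by rw [htab]; simp) (Steps.ite_false ?_ (Steps.seq ?_))
        · rw [Expr.eval_lt_eq_zero, Expr.eval_get, hws]
          exact fun h => hmem ((hs.mark w).1 (hs.reg_three.symm.trans_lt h))
        · have e1 := Steps.store
            (l := .seq (.assign 6 (.add (.reg 6) (.lit 1)))
              (.store (.work 2) (.get (.rightNbr i) (.get (.leftNbr j) cur)) (.reg 6)) :: l)
            (s := s) (a := .work 0) (e := .reg 6)
            (f := .get (.rightNbr i) (.get (.leftNbr j) cur))
          rw [hws] at e1
          have e2 := Steps.assign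
            (l := .store (.work 2) (.get (.rightNbr i) (.get (.leftNbr j) cur)) (.reg 6) :: l)
            (s := s1) (r := 6) (e := .add (.reg 6) (.lit 1))
          have e3 := Steps.store (l := l) (s := s2) (a := .work 2)
            (e := .get (.rightNbr i) (.get (.leftNbr j) cur)) (f := .reg 6)
          have h26 : (Expr.reg 6).eval s2 = s.reg 6 + 1 := by simp [Expr.eval, hs2]
          rw [hw' s2 hhead (fun _ => ?_) (fun _ => ?_), h26] at e3
          · exact (e1.trans (Steps.seq (e2.trans e3))).mono (by norm_num)
          · rw [hs2, State.arr_setReg, hs1, State.arr_setArr_of_ne _ _ _ (by simp)]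
          · rw [hs2, State.arr_setReg, hs1, State.arr_setArr_of_ne _ _ _ (by simp)]
      · have hmark : ∀ w' : Fin n, s3.arr (.work 2) w' =
            if w' = w then s.reg 6 + 1 else s.arr (.work 2) w' := fun w' => by
          rw [hs3, State.arr_setArr_self, hs2, State.arr_setReg, hs1,
            State.arr_setArr_of_ne _ _ _ (by simp)]
          simp [Fin.val_inj]
        refine ⟨hs.holds.congr (fun u => by rw [hne _ (by simp) (by simp), hs.holds.word])
          (fun _ => hne _ (by simp) (by simp)) fun _ => hne _ (by simp) (by simp), ?_, ?_, ?_, ?_,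
          ?_, ?_, fun w' => ?_, fun w' => ?_⟩
        · rw [hreg 4 (by simp)]
          exact (hs.old.setArr (by rw [List.length_cons]; omega)).congr h30
        · rw [hreg 3 (by simp), hs.reg_three]
        · rw [hreg 4 (by simp), hs.old_end]
        · exact (hs.new.append h6 rfl).congr h30
        · rw [List.nodup_append]
          refine ⟨hs.nodup, by simp, ?_⟩
          rintro a ha b hb rfl
          rw [List.mem_singleton] at hb
          exact hmem (hb ▸ ha)
        · rw [List.length_append, List.length_singleton]
          simp [hs3, hs2]
          omega
        · rw [hmark, List.mem_append, List.mem_singleton]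
          split_ifs with hww
          · simp only [hww, or_true, iff_true]
            omega
          · rw [hs.mark]
            simp [hww]
        · rw [hmark, List.length_append, List.length_singleton]
          have := hs.mark_le w'
          split_ifs <;> omega
      · intro w'
        rw [List.mem_append, List.mem_singleton]
        simp [hun]
  · have hun' : ¬ localView A x v ∉ C := hun
    rw [if_neg hun'] at htab
    refine ⟨s, L, (Steps.ite_false htab Steps.skip).mono (by norm_num), hs, fun w' => ?_⟩
    simp [hun]

theorem pushNbrs_steps {h : ℕ} {u : Fin n} {us L : List (Fin n)} (ps : List (Fin c × Fin d))
    (hs : Collecting A x h (u :: us) L s) :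
    ∃ s' L', Steps (8 * ps.length + 1) ⟨pushNbrs C ps :: l, s⟩ ⟨l, s'⟩ ∧
      Collecting A x h (u :: us) L' s' ∧
      ∀ w, w ∈ L' ↔ w ∈ L ∨ ∃ p ∈ ps, (A.left u p.1 : Fin m) ∈ unsat A C x ∧
        w = A.right (A.left u p.1) p.2 := by
  induction ps generalizing s L with
  | nil => exact ⟨s, L, Steps.skip, hs, by simp⟩
  | cons p ps ih =>
    obtain ⟨s1, L1, h1, h2, h3⟩ := pushNbr_steps (C := C) (l := pushNbrs C ps :: l) hs p.1 p.2
    obtain ⟨s2, L2, h4, h5, h6⟩ := ih h2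
    refine ⟨s2, L2, (Steps.seq (h1.trans h4)).mono (by rw [List.length_cons]; omega), h5,
      fun w => ?_⟩
    rw [h6, h3, List.exists_mem_cons_iff, or_assoc]

theorem collectLoop_steps {h : ℕ} {us L : List (Fin n)} (hs : Collecting A x h us L s) :
    ∃ s' L', Steps ((8 * (c * d) + 4) * us.length + 1)
        ⟨forLoop 3 (pushNbrs C (Finset.univ : Finset (Fin c × Fin d)).toList) :: l, s⟩ ⟨l, s'⟩ ∧
      Collecting A x h [] L' s' ∧
      ∀ w, w ∈ L' ↔ w ∈ L ∨ ∃ u ∈ us, ∃ v ∈ unsat A C x, G.Adj u v ∧ G.Adj w v := by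
  induction us generalizing s L with
  | nil =>
    refine ⟨s, L, (Steps.while_false ?_).mono (by simp), hs, by simp⟩
    simp [Expr.eval, hs.reg_three, hs.old_end]
  | cons u us ih =>
    have hlen := hs.old_end
    rw [List.length_cons] at hlen
    obtain ⟨s1, L1, h1, h2, h3⟩ := pushNbrs_steps (C := C)
      (l := .assign 4 (.add (.reg 4) (.lit 1)) ::
        forLoop 3 (pushNbrs C (Finset.univ : Finset (Fin c × Fin d)).toList) :: l)
      (Finset.univ : Finset (Fin c × Fin d)).toList hs
    have hcard : (Finset.univ : Finset (Fin c × Fin d)).toList.length = c * d := by simp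
    rw [hcard] at h1
    have h0 : Collecting A x h us L1 (s1.setReg 4 (s1.reg 4 + 1)) := by
      have hlen := h2.old_end
      rw [List.length_cons] at hlen
      refine ⟨h2.holds.congr h2.holds.word (fun _ => rfl) fun _ => rfl, ?_, ?_, ?_,
        h2.new.congr rfl, h2.nodup, ?_, h2.mark, h2.mark_le⟩
      · simpa using h2.old.tail
      · simpa using h2.reg_three
      · simp
        omega
      · simpa using h2.reg_six
    obtain ⟨s2, L2, h4, h5, h6⟩ := ih h0
    refine ⟨s2, L2, (Steps.while_true ?_ (Steps.seq (h1.trans (Steps.assign.trans h4)))).mono ?_,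
      h5, fun w => ?_⟩
    · simp [Expr.eval, hs.reg_three, hlen]
    · rw [List.length_cons]
      ring_nf
      omega
    · rw [h6, h3, List.exists_mem_cons_iff, or_assoc]
      -- The index pairs enumerate the paths of length two starting at `u`.
      refine or_congr_right (or_congr_left ?_)
      constructor
      · rintro ⟨p, -, hp, rfl⟩
        exact ⟨_, hp, (A.left u p.1).2, (A.right _ p.2).2⟩
      · rintro ⟨v, hv, huv, hwv⟩
        obtain ⟨j, hj⟩ := (A.left u).surjective ⟨v, huv⟩
        have hj' : (A.left u j : Fin m) = v := congrArg Subtype.val hj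
        obtain ⟨i, hi⟩ := (A.right v).surjective ⟨w, hwv⟩
        subst hj'
        exact ⟨(j, i), by simp, hv, (congrArg Subtype.val hi).symm⟩

variable (A C x) in
/-- The state of the machine at the beginning of a round: the queue `us` lists the neighbours of the
unsatisfied checks. -/
structure Ready (us : List (Fin n)) (s : State) : Prop where
  holds : Holds A x s
  queued : Queued s (s.reg 2) us
  reg_three : s.reg 3 = s.reg 2 + us.length
  nodup : us.Nodup
  mem : ∀ u, u ∈ us ↔ ∃ v ∈ unsat A C x, G.Adj u v
  mark_le : ∀ u : Fin n, s.arr (.work 2) u ≤ s.reg 3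

/-- The hypothesis `hcov` is what permits a local search: if every unsatisfied check touches the old
queue, then scanning the checks around that queue finds them all. -/
theorem collect_steps {us : List (Fin n)} (hs : Holds A x s) (hq : Queued s (s.reg 2) us)
    (h3 : s.reg 3 = s.reg 2 + us.length) (hm : ∀ u : Fin n, s.arr (.work 2) u ≤ s.reg 3)
    (hcov : ∀ v ∈ unsat A C x, ∃ u ∈ us, G.Adj u v) :
    ∃ s' us', Steps ((8 * (c * d) + 4) * us.length + 9) ⟨collect c C :: l, s⟩ ⟨l, s'⟩ ∧
      Ready A C x us' s' := by
  have h0 : Collecting A x (s.reg 3) us [] ((s.setReg 6 (s.reg 3)).setReg 4 (s.reg 2)) := by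
    refine ⟨hs.congr hs.word (fun _ => rfl) fun _ => rfl, ?_, by simp, by simpa using h3,
      fun k hk => by simp at hk, by simp, by simp, fun u => ?_, fun u => ?_⟩
    · simpa using hq
    · simpa using hm u
    · simpa using hm u
  obtain ⟨s1, L, h1, h2, h4⟩ := collectLoop_steps (C := C)
    (l := .seq (.assign 2 (.reg 3)) (.assign 3 (.reg 6)) :: l) h0
  refine ⟨(s1.setReg 2 (s1.reg 3)).setReg 3 (s1.reg 6), L, ?_, ?_⟩
  · have e1 : Steps 1 ⟨.assign 6 (.reg 3) :: .seq (.assign 4 (.reg 2))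
        (.seq (forLoop 3 (pushNbrs C (Finset.univ : Finset (Fin c × Fin d)).toList))
          (.seq (.assign 2 (.reg 3)) (.assign 3 (.reg 6)))) :: l, s⟩ _ := Steps.assign
    exact (Steps.seq (e1.trans (Steps.seq (Steps.assign.trans (Steps.seq (h1.trans
      (Steps.seq (Steps.assign.trans Steps.assign)))))))).mono (by omega)
  · have h6 := h2.reg_six
    have h3 := h2.reg_three
    refine ⟨h2.holds.congr h2.holds.word (fun _ => rfl) fun _ => rfl, ?_, ?_, h2.nodup,
      fun u => ?_, fun u => ?_⟩
    · simpa [h3] using h2.new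
    · simp
      omega
    · rw [h4]
      simp only [List.not_mem_nil, false_or]
      constructor
      · rintro ⟨_, -, v, hv, -, huv⟩
        exact ⟨v, hv, huv⟩
      · rintro ⟨v, hv, huv⟩
        obtain ⟨w, hw, hwv⟩ := hcov v hv
        exact ⟨w, hw, v, hv, hwv, huv⟩
    · have := h2.mark_le u
      simp
      omega

end Correctness

/-! ### Decoding -/

section Decode

variable {d : ℕ} (C : Submodule (ZMod 2) (Fin d → ZMod 2))

theorem decode_mem (w : Fin d → ZMod 2) : decode C w ∈ C :=
  Function.argminOn_mem (decodeKey w) (C : Set (Fin d → ZMod 2)) _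

theorem hammingDist_decode_le (w : Fin d → ZMod 2) {z : Fin d → ZMod 2} (hz : z ∈ C) :
    hammingDist w (decode C w) ≤ hammingDist w z := by
  have h : decodeKey w (decode C w) ≤ decodeKey w z :=
    Function.argminOn_le (decodeKey w) (C : Set (Fin d → ZMod 2)) hz
  rcases Prod.Lex.toLex_le_toLex.1 h with h | h
  · exact h.le
  · exact h.1.le

theorem decode_eq_self {w : Fin d → ZMod 2} (hw : w ∈ C) : decode C w = w := by
  have := hammingDist_decode_le C w hw
  rw [hammingDist_self, Nat.le_zero, hammingDist_eq_zero] at this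
  exact this.symm

end Decode

/-! ### Whole rounds, the main loop and the initialization. -/

section Correctness

variable {n m c d : ℕ} {G : BipGraph n m} {A : AdjLists G c d}
  {C : Submodule (ZMod 2) (Fin d → ZMod 2)} {x : Fin n → ZMod 2} {s s' : State} {l : List Prog}

theorem vote_eq_zero_of_notMem_unsat {v : Fin m} (hv : v ∉ unsat A C x) (u : Fin n) :
    vote A C x v u = 0 := by
  have h : localView A x v ∈ C := not_not.1 hv
  have h0 : localDist A C x v = 0 := by
    rw [localDist, decode_eq_self C h, hammingDist_self]
  simp [vote, h0]

theorem flipProb_eq_zero {u : Fin n} (h : ∀ v ∈ unsat A C x, ¬ G.Adj u v) :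
    flipProb A C x u = 0 := by
  refine Finset.sum_eq_zero fun v _ => ?_
  by_cases hv : v ∈ unsat A C x
  · exact vote_eq_zero A C x v u (h v hv)
  · exact vote_eq_zero_of_notMem_unsat hv u

theorem flipRound_reaches (hc : 0 < c) (hd : 0 < d) {us : List (Fin n)} (hs : Ready A C x us s) :
    Reaches ((8 * (c * d) + 14) * us.length + 17) ⟨flipRound c C :: l, s⟩ (randFlip A C x)
      fun x' κ => ∃ s' us', κ = ⟨l, s'⟩ ∧ Ready A C x' us' s' := by
  have h0 : Steps 3 ⟨flipRound c C :: l, s⟩ _ := Steps.seq (Steps.assign.trans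
    (Steps.seq (Steps.refl _)))
  -- The trailing `bind` with `PMF.pure` accounts for the deterministic phases after the draws.
  rw [← drawPMF_eq_randFlip hs.nodup fun u hu => flipProb_eq_zero fun v hv huv =>
    hu ((hs.mem u).2 ⟨v, hv, huv⟩), ← PMF.bind_pure (drawPMF A C x us x)]
  have e4 : ((s.setReg 4 ((Expr.reg 2).eval s)).reg 4) = s.reg 2 := by simp [Expr.eval]
  refine ((Reaches.of_steps h0 ((draw_reaches hc us x ∅ ?_ ?_ ?_ ?_).bind
    (N := (4 * us.length + 1) + ((8 * (c * d) + 4) * us.length + 9) + 3) ?_)).mono ?_)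
  · exact hs.holds.congr hs.holds.word (fun _ => rfl) fun _ => rfl
  · rw [e4]
    simpa using hs.queued
  · rw [e4]
    simpa using hs.reg_three
  · simp
  · rintro z _ ⟨hz, s1, rfl, ha, hr, hbit⟩
    have hr2 : s1.reg 2 = s.reg 2 := by simp [hr 2]
    have hr3 : s1.reg 3 = s.reg 3 := by simp [hr 3]
    have h1 : Steps 3 ⟨.seq (.assign 4 (.reg 2)) (.seq (forLoop 3 commitBit) (collect c C)) :: l,
        s1⟩ _ := Steps.seq (Steps.assign.trans (Steps.seq (Steps.refl _)))
    have hq1 : Queued s1 (s.reg 2) us := hs.queued.congr (ha (.work 0) (by simp))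
    obtain ⟨s2, h2, ha2, hr2', hw⟩ := commit_steps (l := collect c C :: l)
      (s := s1.setReg 4 ((Expr.reg 2).eval s1)) us (by simpa [Expr.eval, hr2] using hq1)
      (by simp [Expr.eval, hr2, hr3, hs.reg_three])
    have hne : ∀ a, a ≠ .word → a ≠ .work 1 → s2.arr a = s.arr a := fun a h0 h1 =>
      (ha2 a h0).trans (ha a h1)
    have hg2 : s2.reg 2 = s.reg 2 := by
      rw [hr2' 2 (by simp)]
      simp [hr2]
    have hg3 : s2.reg 3 = s.reg 3 := by
      rw [hr2' 3 (by simp)]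
      simp [hr3]
    have hH : Holds A z s2 := by
      refine hs.holds.congr (fun u => ?_) (fun i => hne _ (by simp) (by simp))
        fun j => hne _ (by simp) (by simp)
      rw [hw]
      split_ifs with hu
      · exact hbit u (Or.inr hu)
      · rw [hz u hu, State.arr_setReg, ha _ (by simp), State.arr_setReg, hs.holds.word]
    obtain ⟨s3, us', h3, hR⟩ := collect_steps (C := C) (l := l) hH (us := us)
      (by rw [hg2]; exact hs.queued.congr (hne _ (by simp) (by simp)))
      (by rw [hg2, hg3, hs.reg_three])
      (fun u => by rw [hg3, hne _ (by simp) (by simp)]; exact hs.mark_le u)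
      -- If no neighbour of `v` is queued, its view is unchanged, so `v` was unsatisfied before; but
      -- then all its neighbours are queued, and there is one since `d > 0`.
      (fun v hv => by
        by_contra! hcon
        have hloc : localView A z v = localView A x v := by
          funext i
          exact hz _ fun hmem => hcon _ hmem (A.right v i).2
        have hv' : v ∈ unsat A C x := by
          unfold unsat at hv ⊢
          rwa [Set.mem_ofPred_eq, hloc] at hv
        have hadj := (A.right v ⟨0, hd⟩).2
        exact hcon _ ((hs.mem _).2 ⟨v, hv', hadj⟩) hadj)
    exact (Reaches.of_steps (h1.trans (h2.trans h3)) (Reaches.of_pure ⟨s3, us', rfl, hR⟩)).mono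
      (by omega)
  · ring_nf
    omega

theorem unsat_eq_empty_iff {us : List (Fin n)} (hd : 0 < d) (hs : Ready A C x us s) :
    unsat A C x = ∅ ↔ us = [] := by
  rw [List.eq_nil_iff_forall_not_mem, Set.eq_empty_iff_forall_notMem]
  constructor
  · intro h u hu
    obtain ⟨v, hv, -⟩ := (hs.mem u).1 hu
    exact h v hv
  · intro h v hv
    exact h _ ((hs.mem _).2 ⟨v, hv, (A.right v ⟨0, hd⟩).2⟩)

theorem mainLoop_step {us : List (Fin n)} (hd : 0 < d) (hs : Ready A C x us s)
    (hU : unsat A C x ≠ ∅) :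
    step ⟨mainLoop c C :: l, s⟩ = PMF.pure ⟨flipRound c C :: mainLoop c C :: l, s⟩ := by
  have : 0 < us.length := List.length_pos_iff.2 (mt (unsat_eq_empty_iff hd hs).2 hU)
  have h3 := hs.reg_three
  simp [mainLoop, step, Expr.eval, h3, List.length_pos_iff.1 this]

theorem mainLoop_halts {us : List (Fin n)} (hd : 0 < d) (hs : Ready A C x us s)
    (hU : unsat A C x = ∅) : Steps 1 ⟨mainLoop c C :: l, s⟩ ⟨l, s⟩ := by
  have : us = [] := (unsat_eq_empty_iff hd hs).1 hU
  refine Steps.while_false ?_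
  rw [Expr.eval_lt_eq_zero]
  simp [Expr.eval, hs.reg_three, this]

theorem mainLoop_reaches (hc : 0 < c) (hd : 0 < d) {us : List (Fin n)} (hs : Ready A C x us s)
    (hU : unsat A C x ≠ ∅) :
    Reaches ((8 * (c * d) + 14) * us.length + 18) ⟨mainLoop c C :: l, s⟩ (randFlip A C x)
      fun x' κ => ∃ s' us', κ = ⟨mainLoop c C :: l, s'⟩ ∧ Ready A C x' us' s' :=
  (Reaches.of_steps (.of_step (mainLoop_step hd hs hU)) (flipRound_reaches hc hd hs)).mono
    (by omega)

theorem fill_steps (r : ℕ) (hr : s.reg 4 + r = s.reg 0) :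
    ∃ s', Steps (4 * r + 1) ⟨forLoop 0 (.store (.work 0) (.reg 4) (.reg 4)) :: l, s⟩ ⟨l, s'⟩ ∧
      (∀ a, a ≠ .work 0 → s'.arr a = s.arr a) ∧ (∀ q, q ≠ 4 → s'.reg q = s.reg q) ∧
      ∀ k, s'.arr (.work 0) k = if s.reg 4 ≤ k ∧ k < s.reg 0 then k else s.arr (.work 0) k := by
  induction r generalizing s with
  | zero =>
    refine ⟨s, Steps.while_false ?_, fun _ _ => rfl, fun _ _ => rfl, fun k => ?_⟩
    · rw [Expr.eval_lt_eq_zero]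
      simp only [Expr.eval]
      omega
    · rw [if_neg (by omega)]
  | succ r ih =>
    obtain ⟨s', h1, h2, h3, h4⟩ := ih
      (s := (s.setArr (.work 0) (s.reg 4) (s.reg 4)).setReg 4 (s.reg 4 + 1)) (by simp; omega)
    refine ⟨s', (Steps.while_true ?_ (Steps.seq (Steps.store.trans (Steps.assign.trans h1)))).mono
      (by omega), fun a ha => ?_, fun q hq => ?_, fun k => ?_⟩
    · rw [Ne, Expr.eval_lt_eq_zero]
      simp only [Expr.eval]
      omega
    · rw [h2 a ha, State.arr_setReg, State.arr_setArr_of_ne _ _ _ ha]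
    · rw [h3 q hq]
      simp [hq]
    · rw [h4, State.arr_setReg, State.arr_setArr_self]
      simp only [State.reg_setReg, State.reg_setArr, if_true, if_neg (show ¬ (0 : ℕ) = 4 by decide)]
      split_ifs <;> omega

/-- The first queue consists of all vertices. This is the only scan whose cost is not governed by
the number of errors. -/
theorem init_steps (x : Fin n → ZMod 2) :
    ∃ s us, Steps ((8 * (c * d) + 8) * n + 14) ⟨[decoder c C], inputState A x⟩
      ⟨[mainLoop c C], s⟩ ∧ Ready A C x us s := by
  obtain ⟨s1, h1, ha, hr, hq⟩ := fill_steps (s := inputState A x)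
    (l := [.seq (.assign 3 (.reg 0)) (.seq (collect c C) (mainLoop c C))]) n
    (by simp [inputState])
  have hin : Holds A x (inputState A x) :=
    ⟨fun u => by simp [inputState], fun v i => by simp [inputState],
      fun u j => by simp [inputState]⟩
  have hr0 : s1.reg 0 = n := by rw [hr 0 (by simp)]; rfl
  have hr2 : s1.reg 2 = 0 := by rw [hr 2 (by simp)]; rfl
  obtain ⟨s2, us, h2, hs⟩ := collect_steps (A := A) (C := C) (x := x) (l := [mainLoop c C])
    (s := s1.setReg 3 ((Expr.reg 0).eval s1)) (us := List.finRange n)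
    (hin.congr (fun u => by rw [State.arr_setReg, ha _ (by simp), hin.word])
      (fun i => by rw [State.arr_setReg, ha _ (by simp)])
      fun j => by rw [State.arr_setReg, ha _ (by simp)])
    (by
      intro k hk
      rw [List.length_finRange] at hk
      simp [hr2, hq, inputState, hk])
    (by simp [hr2, Expr.eval, hr0])
    (fun u => by
      rw [State.arr_setReg, ha _ (by simp)]
      exact Nat.zero_le _)
    (fun v hv => by
      -- The zero word lies in `C`, so an unsatisfied view has a nonzero coordinate; in particular
      -- the check has a neighbour.
      obtain ⟨i, hi⟩ : ∃ i, localView A x v i ≠ 0 := by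
        by_contra! h
        exact hv (by rw [show localView A x v = 0 from funext h]; exact C.zero_mem)
      exact ⟨_, List.mem_finRange _, (A.right v i).2⟩)
  rw [List.length_finRange] at h2
  refine ⟨s2, us, (Steps.seq (h1.trans (Steps.seq (Steps.assign.trans (Steps.seq h2))))).mono ?_,
    hs⟩
  ring_nf
  omega

/-! ### The halting probabilities of the program and of the algorithm -/

variable (A C) in
/-- The probability that `RandDecode(x)` outputs `z` after at most `k` executions of its loop. -/
noncomputable def outputWithin (k : ℕ) (x z : Fin n → ZMod 2) : ℝ≥0∞ :=
  (randDecodeIter A C x k).toOuterMeasure {z' | z' = z ∧ (unsat A C z').ncard = 0}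

/-- The definition appends a round at the end; splitting off the first round matches the inductions
along the run of the machine. -/
theorem randDecodeIter_succ (x : Fin n → ZMod 2) (k : ℕ) [Decidable (unsat A C x = ∅)] :
    randDecodeIter A C x (k + 1) =
      (if unsat A C x = ∅ then PMF.pure x else randFlip A C x).bind
        fun x' => randDecodeIter A C x' k := by
  induction k with
  | zero =>
    have h : 0 < (unsat A C x).ncard ↔ unsat A C x ≠ ∅ := by
      rw [Set.ncard_pos (Set.toFinite _), Set.nonempty_iff_ne_empty]
    simp only [randDecodeIter, PMF.pure_bind, PMF.bind_pure, h]
    split_ifs <;> simp_all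
  | succ k ih =>
    rw [randDecodeIter, ih, PMF.bind_bind]
    rfl

theorem outputWithin_of_unsat_eq_empty (h : unsat A C x = ∅) (k : ℕ) (z : Fin n → ZMod 2)
    [Decidable (x = z)] : outputWithin A C k x z = if x = z then 1 else 0 := by
  classical
  have hk : randDecodeIter A C x k = PMF.pure x := by
    induction k with
    | zero => rfl
    | succ k ih => rw [randDecodeIter_succ, if_pos h, PMF.pure_bind, ih]
  rw [outputWithin, hk, PMF.toOuterMeasure_pure_apply]
  simp [h]

theorem outputWithin_zero (h : unsat A C x ≠ ∅) (z : Fin n → ZMod 2) :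
    outputWithin A C 0 x z = 0 := by
  classical
  rw [outputWithin, randDecodeIter, PMF.toOuterMeasure_pure_apply, if_neg]
  rintro ⟨-, h0⟩
  exact h ((Set.ncard_eq_zero (Set.toFinite _)).1 h0)

theorem outputWithin_succ (h : unsat A C x ≠ ∅) (k : ℕ) (z : Fin n → ZMod 2) :
    outputWithin A C (k + 1) x z = ∑' x', randFlip A C x x' * outputWithin A C k x' z := by
  classical
  rw [outputWithin, randDecodeIter_succ, if_neg h, PMF.toOuterMeasure_bind_apply]
  rfl

theorem outputWithin_mono (x z : Fin n → ZMod 2) : Monotone fun k => outputWithin A C k x z := by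
  classical
  refine monotone_nat_of_le_succ fun k => ?_
  induction k generalizing x with
  | zero =>
    by_cases h : unsat A C x = ∅
    · rw [outputWithin_of_unsat_eq_empty h, outputWithin_of_unsat_eq_empty h]
    · rw [outputWithin_zero h]
      exact zero_le
  | succ k ih =>
    by_cases h : unsat A C x = ∅
    · rw [outputWithin_of_unsat_eq_empty h, outputWithin_of_unsat_eq_empty h]
    · rw [outputWithin_succ h, outputWithin_succ h]
      refine ENNReal.tsum_le_tsum fun x' => ?_
      gcongr
      exact ih x'

/-- A finite sum commutes with the monotone supremum over the number of rounds. -/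
theorem tsum_randFlip_mul_le (h : unsat A C x ≠ ∅) (z : Fin n → ZMod 2) :
    ∑' x', randFlip A C x x' * randDecodeProb A C x' z ≤ randDecodeProb A C x z := by
  have hp : ∀ x', randDecodeProb A C x' z = ⨆ k, outputWithin A C k x' z := fun _ => rfl
  simp_rw [hp, ENNReal.mul_iSup]
  rw [tsum_fintype, ENNReal.finsetSum_iSup_of_monotone]
  · refine iSup_le fun k => le_trans (le_of_eq ?_) (le_iSup _ (k + 1))
    rw [outputWithin_succ h, tsum_fintype]
  · intro x' k k' hk
    dsimp only
    gcongr
    exact outputWithin_mono x' z hk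

/-- The states in which the array `word` holds `z`. -/
def holdsWord (z : Fin n → ZMod 2) : Set State := {s | ∀ u : Fin n, s.arr .word u = (z u).val}

theorem Ready.mem_holdsWord {us : List (Fin n)} (hs : Ready A C x us s) (z : Fin n → ZMod 2) :
    s ∈ holdsWord z ↔ x = z := by
  unfold holdsWord
  simp only [Set.mem_ofPred_eq, hs.holds.word, funext_iff]
  exact forall_congr' fun u => (ZMod.val_injective 2).eq_iff

theorem haltProb_mainLoop_le (hc : 0 < c) (hd : 0 < d) (z : Fin n → ZMod 2) (T : ℕ)
    {us : List (Fin n)} (hs : Ready A C x us s) :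
    haltProb (holdsWord z) T ⟨[mainLoop c C], s⟩ ≤ randDecodeProb A C x z := by
  classical
  induction T generalizing x s us with
  | zero =>
    rw [haltProb_zero_cons]
    exact zero_le
  | succ T ih =>
    by_cases hU : unsat A C x = ∅
    · refine ((mainLoop_halts hd hs hU).haltProb_le _ _).trans ?_
      rw [haltProb_nil, if_congr (hs.mem_holdsWord z) rfl rfl,
        ← outputWithin_of_unsat_eq_empty hU 0 z]
      exact le_iSup (fun k => outputWithin A C k x z) 0
    · have h1 : haltProb (holdsWord z) (T + 1) ⟨[mainLoop c C], s⟩ =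
          haltProb (holdsWord z) T ⟨[flipRound c C, mainLoop c C], s⟩ := by
        unfold haltProb
        rw [add_comm T 1, runSteps_add, runSteps_one, mainLoop_step hd hs hU, PMF.pure_bind]
      rw [h1]
      refine ((flipRound_reaches hc hd hs _ T fun x' => randDecodeProb A C x' z).2 ?_).trans
        (tsum_randFlip_mul_le hU z)
      rintro x' _ ⟨s', us', rfl, hs'⟩
      exact ih hs'

/-- The queue never has more than `n` entries. This crude bound per round suffices for comparing the
limits; the linear bound is proved separately. -/
theorem outputWithin_le_haltProb (hc : 0 < c) (hd : 0 < d) (z : Fin n → ZMod 2) (k : ℕ)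
    {us : List (Fin n)} (hs : Ready A C x us s) :
    outputWithin A C k x z ≤ haltProb (holdsWord z) (k * ((8 * (c * d) + 14) * n + 18) + 1)
      ⟨[mainLoop c C], s⟩ := by
  classical
  by_cases hU : unsat A C x = ∅
  · rw [outputWithin_of_unsat_eq_empty hU, ← if_congr (hs.mem_holdsWord z) rfl rfl,
      ← haltProb_nil _ (k * ((8 * (c * d) + 14) * n + 18)) s]
    exact (mainLoop_halts hd hs hU).le_haltProb _ _
  · induction k generalizing x s us with
    | zero =>
      rw [outputWithin_zero hU]
      exact zero_le
    | succ k ih =>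
      have hlen : us.length ≤ n := by
        simpa using hs.nodup.length_le_card
      rw [outputWithin_succ hU]
      refine (((mainLoop_reaches hc hd hs hU) _ (k * ((8 * (c * d) + 14) * n + 18) + 1)
        fun x' => outputWithin A C k x' z).1 ?_).trans (haltProb_mono _ _ ?_)
      · rintro x' _ ⟨s', us', rfl, hs'⟩
        by_cases hU' : unsat A C x' = ∅
        · rw [outputWithin_of_unsat_eq_empty hU', ← if_congr (hs'.mem_holdsWord z) rfl rfl,
            ← haltProb_nil _ (k * ((8 * (c * d) + 14) * n + 18)) s']
          exact (mainLoop_halts hd hs' hU').le_haltProb _ _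
        · exact ih hs' hU'
      · have := Nat.mul_le_mul_left (8 * (c * d) + 14) hlen
        rw [add_one_mul k]
        omega

theorem outputProb_eq_haltProb (P : Prog) (A : AdjLists G c d) (x z : Fin n → ZMod 2) (T : ℕ) :
    outputProb P A x T z = haltProb (holdsWord z) T ⟨[P], inputState A x⟩ := rfl

theorem implementsRandDecode_decoder (hc : 0 < c) (hd : 0 < d)
    (C : Submodule (ZMod 2) (Fin d → ZMod 2)) :
    ImplementsRandDecode (decoder c C) c d C := by
  intro n m G A x z _
  obtain ⟨s, us, h, hs⟩ := init_steps (A := A) (C := C) x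
  simp_rw [outputProb_eq_haltProb]
  refine le_antisymm (iSup_le fun T => (h.haltProb_le _ T).trans
    (haltProb_mainLoop_le hc hd z T hs)) (iSup_le fun k => ?_)
  exact (outputWithin_le_haltProb hc hd z k hs).trans ((h.le_haltProb _ _).trans
    (le_iSup (fun T => haltProb (holdsWord z) T ⟨[decoder c C], inputState A x⟩) _))

end Correctness

/-! ### Sums over product weights -/

section ProductWeights

variable {ι β : Type*} [Fintype ι] [DecidableEq ι] [Fintype β] {w f : ι → β → ℝ}

theorem sum_prod_mul_prod (w g : ι → β → ℝ) :
    ∑ z : ι → β, (∏ i, w i (z i)) * ∏ i, g i (z i) = ∏ i, ∑ b, w i b * g i b := by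
  simp_rw [← Finset.prod_mul_distrib]
  exact (Fintype.prod_sum fun i b => w i b * g i b).symm

theorem sum_prod_weights (hw : ∀ i, ∑ b, w i b = 1) : ∑ z : ι → β, ∏ i, w i (z i) = 1 := by
  simpa [hw] using sum_prod_mul_prod w fun _ _ => 1

theorem sum_prod_weights_mul (hw : ∀ i, ∑ b, w i b = 1) (i : ι) (g : β → ℝ) :
    ∑ z : ι → β, (∏ j, w j (z j)) * g (z i) = ∑ b, w i b * g b := by
  have h := sum_prod_mul_prod w fun j b => if j = i then g b else 1
  simp only [Fintype.prod_ite_eq'] at h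
  rw [h, Finset.prod_eq_single i]
  · simp
  · intro j _ hj
    simp [hj, hw]
  · simp

/-- Independent centred variables are uncorrelated: the factor at `i` of the product vanishes. -/
theorem sum_prod_weights_mul_mul (hf : ∀ i, ∑ b, w i b * f i b = 0) {i j : ι} (hij : i ≠ j) :
    ∑ z : ι → β, (∏ k, w k (z k)) * (f i (z i) * f j (z j)) = 0 := by
  have h := sum_prod_mul_prod w fun k b => (if k = i then f i b else 1) *
    if k = j then f j b else 1
  simp only [Finset.prod_mul_distrib, Fintype.prod_ite_eq'] at h
  rw [h]
  refine Finset.prod_eq_zero (Finset.mem_univ i) ?_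
  simp [hij, hf]

theorem sum_prod_weights_mul_sum (hw : ∀ i, ∑ b, w i b = 1) (hf : ∀ i, ∑ b, w i b * f i b = 0) :
    ∑ z : ι → β, (∏ k, w k (z k)) * ∑ i, f i (z i) = 0 := by
  simp_rw [Finset.mul_sum]
  rw [Finset.sum_comm]
  exact Finset.sum_eq_zero fun i _ => by rw [sum_prod_weights_mul hw, hf]

theorem sum_prod_weights_mul_sq (hw : ∀ i, ∑ b, w i b = 1) (hf : ∀ i, ∑ b, w i b * f i b = 0) :
    ∑ z : ι → β, (∏ k, w k (z k)) * (∑ i, f i (z i)) ^ 2 = ∑ i, ∑ b, w i b * f i b ^ 2 := by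
  simp_rw [sq (∑ i, f i _), Finset.sum_mul_sum, Finset.mul_sum]
  rw [Finset.sum_comm]
  refine Finset.sum_congr rfl fun i _ => ?_
  rw [Finset.sum_comm, Finset.sum_eq_single i]
  · simp_rw [← sq]
    exact sum_prod_weights_mul hw i fun b => f i b ^ 2
  · exact fun j _ hj => sum_prod_weights_mul_mul hf hj.symm
  · simp

end ProductWeights

/-! ### The expected effect of `RandFlip` -/

section Drift

variable {n m c d : ℕ} {G : BipGraph n m} {A : AdjLists G c d}
  {C : Submodule (ZMod 2) (Fin d → ZMod 2)} {x y : Fin n → ZMod 2}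

/-- Double counting of the edges. -/
theorem sum_right (A : AdjLists G c d) (f : Fin n → ℕ) :
    ∑ v, ∑ i, f (A.right v i) = ∑ u, c * f u := by
  classical
  have h1 : ∀ v, ∑ i, f (A.right v i) = ∑ u, if G.Adj u v then f u else 0 := fun v => by
    rw [(A.right v).sum_comp fun u => f u, ← Finset.sum_filter]
    exact (Finset.sum_subtype _ (by simp) f).symm
  simp_rw [h1]
  rw [Finset.sum_comm]
  refine Finset.sum_congr rfl fun u _ => ?_
  rw [← Finset.sum_filter, Finset.sum_const, smul_eq_mul, ← Fintype.card_subtype,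
    ← Fintype.card_congr (A.left u), Fintype.card_fin]

/-- The number of errors in the neighbourhood of a check. -/
def localErr (A : AdjLists G c d) (x y : Fin n → ZMod 2) (v : Fin m) : ℕ :=
  hammingDist (localView A x v) (localView A y v)

theorem sum_localErr : ∑ v, localErr A x y v = c * hammingDist x y := by
  have h : ∀ v, localErr A x y v =
      ∑ i, (fun u => if x u ≠ y u then 1 else 0) (A.right v i : Fin n) := fun v => by
    rw [localErr, hammingDist, Finset.card_filter]
    rfl
  rw [Finset.sum_congr rfl fun v _ => h v,
    sum_right A fun u => if x u ≠ y u then 1 else 0, ← Finset.mul_sum, hammingDist,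
    Finset.card_filter]

theorem localErr_pos_iff {v : Fin m} : 0 < localErr A x y v ↔ v ∈ G.nbhd {u | x u ≠ y u} := by
  rw [localErr, hammingDist_pos, Function.ne_iff]
  constructor
  · rintro ⟨i, hi⟩
    exact ⟨_, hi, (A.right v i).2⟩
  · rintro ⟨u, hu, huv⟩
    obtain ⟨i, hi⟩ := (A.right v).surjective ⟨u, huv⟩
    refine ⟨i, ?_⟩
    have hi' : (A.right v i : Fin n) = u := congrArg Subtype.val hi
    simpa [localView, hi'] using hu

theorem localErr_pos_of_unsat (hy : y ∈ tannerCode A C) {v : Fin m} (hv : v ∈ unsat A C x) :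
    0 < localErr A x y v := by
  rw [localErr, hammingDist_pos]
  intro h
  exact hv (by rw [h]; exact hy v)

theorem vote_cases (v : Fin m) :
    (¬ (1 ≤ localDist A C x v ∧ (localDist A C x v : ℝ) < (minDist C : ℝ) / 2) ∧
      ∀ u, vote A C x v u = 0) ∨
    ((1 ≤ localDist A C x v ∧ (localDist A C x v : ℝ) < (minDist C : ℝ) / 2) ∧
      ∃ i, decode C (localView A x v) i ≠ localView A x v i ∧
        ∀ u, vote A C x v u = if u = A.right v i then
          ((minDist C : ℝ) / 2 - localDist A C x v) / (c * ((minDist C : ℝ) / 2)) else 0) := by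
  by_cases h : 1 ≤ localDist A C x v ∧ (localDist A C x v : ℝ) < (minDist C : ℝ) / 2
  · refine Or.inr ⟨h, ?_⟩
    have hne : {i | decode C (localView A x v) i ≠ localView A x v i}.Nonempty :=
      Function.ne_iff.1 (hammingDist_pos.1 h.1)
    obtain ⟨i, hi, hmin⟩ := WellFounded.has_min (wellFounded_lt (α := Fin d)) _ hne
    have hmin' : ∀ j < i, decode C (localView A x v) j = localView A x v j := fun j hj => by
      by_contra hcon
      exact hmin j hcon hj
    have hiff : ∀ u, IsFirstDiff A C x v u ↔ u = A.right v i := by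
      intro u
      constructor
      · rintro ⟨j, rfl, hj, hlt⟩
        rcases lt_trichotomy i j with hij | rfl | hij
        · exact absurd (hlt i hij) hi
        · rfl
        · exact absurd (hmin' j hij) hj
      · rintro rfl
        exact ⟨i, rfl, hi, hmin'⟩
    refine ⟨i, hi, fun u => ?_⟩
    simp [vote, h, hiff]
  · refine Or.inl ⟨h, fun u => ?_⟩
    unfold vote
    dsimp only
    rw [if_neg fun h' => h ⟨h'.1, h'.2.1⟩]

/-- A check without errors is satisfied and casts no vote; any other votes for one vertex, with
weight at most `1/c`. Summed over the checks, this bounds the variance. -/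
theorem sum_vote_le (hc : 0 < c) (hy : y ∈ tannerCode A C) (v : Fin m) :
    ∑ u, vote A C x v u ≤ (localErr A x y v : ℝ) / c := by
  rcases vote_cases (A := A) (C := C) (x := x) v with ⟨-, h⟩ | ⟨⟨h1, h2⟩, i, hi, h⟩
  · simp only [h, Finset.sum_const_zero]
    positivity
  · have hpos : 0 < localErr A x y v := localErr_pos_of_unsat hy fun hv =>
      hi (by rw [decode_eq_self C hv])
    have h' : ∑ u, vote A C x v u = vote A C x v (A.right v i) := by
      rw [Finset.sum_eq_single (A.right v i : Fin n)]
      · intro u _ hu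
        rw [h, if_neg hu]
      · simp
    rw [h']
    refine (vote_le A C x v _).trans ?_
    gcongr
    exact_mod_cast hpos

theorem sum_flipProb_le (hc : 0 < c) (hy : y ∈ tannerCode A C) :
    ∑ u, flipProb A C x u ≤ hammingDist x y := by
  unfold flipProb
  rw [Finset.sum_comm]
  refine (Finset.sum_le_sum fun v _ => sum_vote_le hc hy v).trans (le_of_eq ?_)
  rw [← Finset.sum_div, ← Nat.cast_sum, sum_localErr]
  push_cast
  field_simp

theorem minDist_le_hammingDist {w z : Fin d → ZMod 2} (hw : w ∈ C) (hz : z ∈ C) (h : w ≠ z) :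
    minDist C ≤ hammingDist w z := Nat.sInf_le ⟨w, hw, z, hz, h, rfl⟩

/-- Let `a` be the local distance and `e > 0` the number of errors; the left side is `(t - e)/(ct)`,
`t = d₀/2`. If decoding finds the view of `y`, the vote hits an error and `a = e`. If it finds
another codeword, then `a + e ≥ d₀`, so even a harmful vote costs at most `(e - t)/(ct)`. If there
is no vote, either `a = 0` and the view is a wrong codeword, so `e ≥ d₀`, or `e ≥ a ≥ t`. -/
theorem le_sum_signed_vote (hc : 0 < c) (h0 : 0 < minDist C) (hy : y ∈ tannerCode A C) (v : Fin m) :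
    (if 0 < localErr A x y v then 1 / (c : ℝ) else 0) - localErr A x y v * (2 / (c * minDist C)) ≤
      ∑ u, (if x u ≠ y u then 1 else -1) * vote A C x v u := by
  have hc' : (0 : ℝ) < c := by exact_mod_cast hc
  have h0' : (0 : ℝ) < minDist C := by exact_mod_cast h0
  have hsymm : localDist A C x v ≤ localErr A x y v := by
    rw [localDist, hammingDist_comm]
    exact hammingDist_decode_le C _ (hy v)
  have key : ∀ e : ℝ, 1 / (c : ℝ) - e * (2 / (c * minDist C)) =
      ((minDist C : ℝ) / 2 - e) / (c * ((minDist C : ℝ) / 2)) := fun e => by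
    field_simp
  rcases vote_cases (A := A) (C := C) (x := x) v with ⟨hn, h⟩ | ⟨⟨h1, h2⟩, i, hi, h⟩
  · simp only [h, mul_zero, Finset.sum_const_zero]
    split_ifs with hpos
    · rw [key]
      refine div_nonpos_of_nonpos_of_nonneg ?_ (by positivity)
      rw [sub_nonpos]
      rcases Nat.eq_zero_or_pos (localDist A C x v) with hz | hz
      · have hmem : localView A x v ∈ C := by
          rw [localDist, hammingDist_eq_zero] at hz
          rw [← hz]
          exact decode_mem C _
        have : (minDist C : ℝ) ≤ localErr A x y v := by
          exact_mod_cast minDist_le_hammingDist hmem (hy v) (hammingDist_pos.1 hpos)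
        linarith
      · have h3 : (minDist C : ℝ) / 2 ≤ localDist A C x v := not_lt.1 fun h' => hn ⟨hz, h'⟩
        exact h3.trans (by exact_mod_cast hsymm)
    · have : (localErr A x y v : ℝ) = 0 := by exact_mod_cast Nat.eq_zero_of_not_pos hpos
      simp [this]
  · have hpos : 0 < localErr A x y v := h1.trans hsymm
    rw [if_pos hpos, key]
    have h' : ∑ u, (if x u ≠ y u then 1 else -1) * vote A C x v u =
        (if x (A.right v i) ≠ y (A.right v i) then 1 else -1) *
          (((minDist C : ℝ) / 2 - localDist A C x v) / (c * ((minDist C : ℝ) / 2))) := by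
      rw [Finset.sum_eq_single (A.right v i : Fin n)]
      · rw [h, if_pos rfl]
      · intro u _ hu
        rw [h, if_neg hu, mul_zero]
      · simp
    rw [h']
    by_cases hdec : decode C (localView A x v) = localView A y v
    · have hxy : x (A.right v i) ≠ y (A.right v i) := by
        rw [hdec] at hi
        exact hi.symm
      have hle : localDist A C x v = localErr A x y v := by
        rw [localDist, hdec, hammingDist_comm]
        rfl
      rw [if_pos hxy, one_mul, hle]
    · have h3 : minDist C ≤ localDist A C x v + localErr A x y v :=
        (minDist_le_hammingDist (decode_mem C _) (hy v) hdec).trans (hammingDist_triangle _ _ _)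
      have h3' : (minDist C : ℝ) ≤ localDist A C x v + localErr A x y v := by exact_mod_cast h3
      have ha : 0 ≤ ((minDist C : ℝ) / 2 - localDist A C x v) / (c * ((minDist C : ℝ) / 2)) :=
        div_nonneg (by linarith) (by positivity)
      have hb : ((minDist C : ℝ) / 2 - localErr A x y v) / (c * ((minDist C : ℝ) / 2)) ≤
          -(((minDist C : ℝ) / 2 - localDist A C x v) / (c * ((minDist C : ℝ) / 2))) := by
        rw [← neg_div]
        gcongr
        linarith
      split_ifs <;> linarith

theorem ncard_ne_eq_hammingDist (x y : Fin n → ZMod 2) :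
    {u | x u ≠ y u}.ncard = hammingDist x y := by
  rw [Set.ncard_eq_toFinset_card', hammingDist]
  congr 1
  ext u
  simp

/-- The checks with errors are the neighbourhood of the set of errors, so expansion bounds the
positive terms from below; the negative ones add up by `sum_localErr`. -/
theorem drift_le {α δ : ℝ} (hc : 0 < c) (h0 : 0 < minDist C) (hG : G.IsExpander c d α δ)
    (hy : y ∈ tannerCode A C) (hα : (hammingDist x y : ℝ) ≤ α * n) :
    (δ - 2 / minDist C) * hammingDist x y ≤
      ∑ u, (if x u ≠ y u then 1 else -1) * flipProb A C x u := by
  classical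
  have hc' : (0 : ℝ) < c := by exact_mod_cast hc
  have h0' : (0 : ℝ) < minDist C := by exact_mod_cast h0
  have hexp := hG.expansion {u | x u ≠ y u} (by rwa [ncard_ne_eq_hammingDist])
  rw [ncard_ne_eq_hammingDist] at hexp
  have hcard : ((G.nbhd {u | x u ≠ y u}).ncard : ℝ) =
      ∑ v, if 0 < localErr A x y v then 1 else 0 := by
    rw [Finset.sum_boole, Set.ncard_eq_toFinset_card']
    congr 2
    ext v
    simp [localErr_pos_iff (A := A)]
  have hsum : ∑ v, ((if 0 < localErr A x y v then 1 / (c : ℝ) else 0) -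
      localErr A x y v * (2 / (c * minDist C))) ≤
        ∑ u, (if x u ≠ y u then 1 else -1) * flipProb A C x u := by
    refine (Finset.sum_le_sum fun v _ => le_sum_signed_vote hc h0 hy v).trans (le_of_eq ?_)
    rw [Finset.sum_comm]
    simp_rw [← Finset.mul_sum]
    rfl
  refine le_trans ?_ hsum
  rw [Finset.sum_sub_distrib, ← Finset.sum_mul, ← Nat.cast_sum, sum_localErr]
  have h1 : ∑ v, (if 0 < localErr A x y v then 1 / (c : ℝ) else 0) =
      ((G.nbhd {u | x u ≠ y u}).ncard : ℝ) / c := by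
    rw [hcard, Finset.sum_div]
    exact Finset.sum_congr rfl fun v _ => by split_ifs <;> simp
  rw [h1]
  have h2 : δ * (hammingDist x y : ℝ) ≤ ((G.nbhd {u | x u ≠ y u}).ncard : ℝ) / c := by
    rw [le_div_iff₀ hc']
    linarith
  have h3 : ((c * hammingDist x y : ℕ) : ℝ) * (2 / (c * minDist C)) =
      2 / minDist C * hammingDist x y := by
    push_cast
    field_simp
  rw [h3]
  linarith

/-- The weights of the values of the bit at `u` after `RandFlip`. -/
noncomputable def bitWeight (A : AdjLists G c d) (C : Submodule (ZMod 2) (Fin d → ZMod 2))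
    (x : Fin n → ZMod 2) (u : Fin n) (b : ZMod 2) : ℝ :=
  if b = x u then 1 - flipProb A C x u else flipProb A C x u

theorem bitWeight_nonneg (u : Fin n) (b : ZMod 2) : 0 ≤ bitWeight A C x u b := by
  unfold bitWeight
  split_ifs
  · exact sub_nonneg.2 (flipProb_le_one A C x u)
  · exact flipProb_nonneg A C x u

theorem randFlip_apply (z : Fin n → ZMod 2) :
    randFlip A C x z = ENNReal.ofReal (∏ u, bitWeight A C x u (z u)) := by
  rw [ENNReal.ofReal_prod_of_nonneg fun u _ => bitWeight_nonneg u _]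
  rw [randFlip, PMF.ofFintype_apply]
  refine Finset.prod_congr rfl fun u _ => ?_
  unfold bitProb bitWeight
  split_ifs <;> rfl

theorem sum_zmod_two {M : Type*} [AddCommMonoid M] (f : ZMod 2 → M) (a : ZMod 2) :
    ∑ b, f b = f a + f (a + 1) := by
  have h : (Finset.univ : Finset (ZMod 2)) = {a, a + 1} := by
    revert a
    decide
  rw [h, Finset.sum_pair (by simp)]

theorem sum_bitWeight (u : Fin n) : ∑ b, bitWeight A C x u b = 1 := by
  simp [sum_zmod_two _ (x u), bitWeight]

variable (A C x y) in
/-- The expected distance from `y` after `RandFlip`. -/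
noncomputable def meanDist : ℝ :=
  ∑ u, if x u ≠ y u then 1 - flipProb A C x u else flipProb A C x u

theorem meanDist_eq : meanDist A C x y =
    hammingDist x y - ∑ u, (if x u ≠ y u then 1 else -1) * flipProb A C x u := by
  rw [meanDist, hammingDist, Finset.card_filter, Nat.cast_sum, ← Finset.sum_sub_distrib]
  refine Finset.sum_congr rfl fun u _ => ?_
  split_ifs <;> simp

theorem bit_centered (u : Fin n) :
    ∑ b, bitWeight A C x u b * ((if b ≠ y u then 1 else 0) -
      if x u ≠ y u then 1 - flipProb A C x u else flipProb A C x u) = 0 := by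
  rw [sum_zmod_two _ (x u)]
  have h2 : ∀ a b : ZMod 2, a ≠ b → a + 1 = b := by decide
  by_cases h : x u = y u
  · simp [bitWeight, h]
    ring
  · simp [bitWeight, h, h2 _ _ h, Ne.symm h]
    ring

/-- A bit flipped with probability `p` has variance `p(1 - p) ≤ p`. -/
theorem bit_variance (u : Fin n) :
    ∑ b, bitWeight A C x u b * ((if b ≠ y u then 1 else 0) -
      if x u ≠ y u then 1 - flipProb A C x u else flipProb A C x u) ^ 2 ≤ flipProb A C x u := by
  rw [sum_zmod_two _ (x u)]
  have h2 : ∀ a b : ZMod 2, a ≠ b → a + 1 = b := by decide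
  by_cases h : x u = y u
  · simp [bitWeight, h]
    nlinarith [sq_nonneg (flipProb A C x u)]
  · simp [bitWeight, h, h2 _ _ h, Ne.symm h]
    nlinarith [sq_nonneg (flipProb A C x u)]

theorem hammingDist_sub_meanDist (z : Fin n → ZMod 2) :
    (hammingDist z y : ℝ) - meanDist A C x y = ∑ u, ((if z u ≠ y u then 1 else 0) -
      if x u ≠ y u then 1 - flipProb A C x u else flipProb A C x u) := by
  rw [Finset.sum_sub_distrib, hammingDist, Finset.card_filter, Nat.cast_sum, meanDist]
  simp

theorem sum_deviation : ∑ z : Fin n → ZMod 2, (∏ u, bitWeight A C x u (z u)) *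
    ((hammingDist z y : ℝ) - meanDist A C x y) = 0 := by
  simp_rw [hammingDist_sub_meanDist]
  exact sum_prod_weights_mul_sum (f := fun u b => (if b ≠ y u then 1 else 0) -
    if x u ≠ y u then 1 - flipProb A C x u else flipProb A C x u) sum_bitWeight bit_centered

theorem sum_sq_deviation_le (hc : 0 < c) (hy : y ∈ tannerCode A C) :
    ∑ z : Fin n → ZMod 2, (∏ u, bitWeight A C x u (z u)) *
      ((hammingDist z y : ℝ) - meanDist A C x y) ^ 2 ≤ hammingDist x y := by
  simp_rw [hammingDist_sub_meanDist]
  rw [sum_prod_weights_mul_sq (f := fun u b => (if b ≠ y u then 1 else 0) -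
    if x u ≠ y u then 1 - flipProb A C x u else flipProb A C x u) sum_bitWeight bit_centered]
  exact (Finset.sum_le_sum fun u _ => bit_variance u).trans (sum_flipProb_le hc hy)

/-! ### The potential -/

/-- A bound for the probability of failure, given the distance `D` of the current word from the
codeword and the amount `b` of work that is left. -/
noncomputable def potential (ε α N D b : ℝ) : ℝ :=
  max (D - ε * b + N) 0 ^ 2 / N ^ 2 + (1 + 1 / (ε * α) ^ 2) / (ε * N ^ 2) * D

/-- A pointwise bound by a quadratic polynomial in the deviation `D' - μ`, so that averaging needs
only its first two moments. Leaving the range `D' ≤ αN` forces a deviation of at least `εαN`, which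
gives the second summand. -/
theorem potential_drop {ε α N D b μ D' : ℝ} (hε : 0 < ε) (hε1 : ε ≤ 1) (hα : 0 < α) (hN : 0 < N)
    (hD : D ≤ α * N) (hμ : μ ≤ (1 - ε) * D) :
    (if D' ≤ α * N then 0 else 1) + potential ε α N D' (b - D) ≤
      (max (D - ε * b + N) 0 + (D' - μ)) ^ 2 / N ^ 2 + (D' - μ) ^ 2 / (ε * α * N) ^ 2 +
        (1 + 1 / (ε * α) ^ 2) / (ε * N ^ 2) * (μ + (D' - μ)) := by
  have h1 : (if D' ≤ α * N then 0 else 1) ≤ (D' - μ) ^ 2 / (ε * α * N) ^ 2 := by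
    split_ifs with h
    · positivity
    · rw [le_div_iff₀ (by positivity), one_mul]
      have h2 : (1 - ε) * D ≤ (1 - ε) * (α * N) :=
        mul_le_mul_of_nonneg_left hD (by linarith)
      refine pow_le_pow_left₀ (by positivity) ?_ 2
      nlinarith
  have h2 : max (D' - ε * (b - D) + N) 0 ^ 2 ≤ (max (D - ε * b + N) 0 + (D' - μ)) ^ 2 := by
    rcases le_total (D' - ε * (b - D) + N) 0 with h | h
    · rw [max_eq_right h, zero_pow two_ne_zero]
      positivity
    · rw [max_eq_left h]
      refine pow_le_pow_left₀ h ?_ 2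
      have := le_max_left (D - ε * b + N) 0
      linarith
  have h3 : max (D' - ε * (b - D) + N) 0 ^ 2 / N ^ 2 ≤
      (max (D - ε * b + N) 0 + (D' - μ)) ^ 2 / N ^ 2 := by gcongr
  rw [potential, add_sub_cancel μ D']
  linarith

theorem sum_potential_le {ε α b : ℝ} (hc : 0 < c) (hn : 0 < n) (hy : y ∈ tannerCode A C)
    (hε : 0 < ε) (hε1 : ε ≤ 1) (hα : 0 < α) (hD : (hammingDist x y : ℝ) ≤ α * n)
    (hμ : meanDist A C x y ≤ (1 - ε) * hammingDist x y) :
    ∑ z : Fin n → ZMod 2, (∏ u, bitWeight A C x u (z u)) *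
      ((if (hammingDist z y : ℝ) ≤ α * n then 0 else 1) +
        potential ε α n (hammingDist z y) (b - hammingDist x y)) ≤
      potential ε α n (hammingDist x y) b := by
  have hN : (0 : ℝ) < n := by exact_mod_cast hn
  set μ := meanDist A C x y
  set D : ℝ := (hammingDist x y : ℝ)
  set N : ℝ := (n : ℝ)
  set Y := max (D - ε * b + N) 0 with hY
  set a := (1 + 1 / (ε * α) ^ 2) / (ε * N ^ 2) with ha
  have ha0 : 0 ≤ a := by positivity
  set q : (Fin n → ZMod 2) → ℝ := fun z => ∏ u, bitWeight A C x u (z u)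
  have hq : ∀ z, 0 ≤ q z := fun z => Finset.prod_nonneg fun u _ => bitWeight_nonneg u _
  have h0 : ∑ z, q z = 1 := sum_prod_weights sum_bitWeight
  have h1 : ∑ z, q z * ((hammingDist z y : ℝ) - μ) = 0 := sum_deviation
  have h2 : ∑ z, q z * ((hammingDist z y : ℝ) - μ) ^ 2 ≤ D := sum_sq_deviation_le hc hy
  set V := ∑ z, q z * ((hammingDist z y : ℝ) - μ) ^ 2
  refine (Finset.sum_le_sum fun z _ => mul_le_mul_of_nonneg_left
    (potential_drop hε hε1 hα hN hD hμ) (hq z)).trans ?_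
  have hexp : ∑ z, q z * ((Y + ((hammingDist z y : ℝ) - μ)) ^ 2 / N ^ 2 +
      ((hammingDist z y : ℝ) - μ) ^ 2 / (ε * α * N) ^ 2 +
        a * (μ + ((hammingDist z y : ℝ) - μ))) =
      (Y ^ 2 / N ^ 2 + a * μ) * ∑ z, q z +
        (2 * Y / N ^ 2 + a) * ∑ z, q z * ((hammingDist z y : ℝ) - μ) +
        (1 / N ^ 2 + 1 / (ε * α * N) ^ 2) * V := by
    simp only [V, Finset.mul_sum, ← Finset.sum_add_distrib]
    refine Finset.sum_congr rfl fun z _ => ?_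
    ring
  rw [hexp, h0, h1, potential]
  -- The coefficient `a` is chosen so that the mean loss `aεD` of the linear term pays for both
  -- variance terms.
  have h3 : (1 / N ^ 2 + 1 / (ε * α * N) ^ 2) * V ≤ a * (ε * D) := by
    have : a * (ε * D) = (1 / N ^ 2 + 1 / (ε * α * N) ^ 2) * D := by
      rw [ha]
      field_simp
    rw [this]
    gcongr
  have h4 : a * μ ≤ a * ((1 - ε) * D) := by gcongr
  linarith

end Drift

/-! ### Success within linear time -/

section Success

variable {n m c d : ℕ} {G : BipGraph n m} {A : AdjLists G c d}
  {C : Submodule (ZMod 2) (Fin d → ZMod 2)} {x y : Fin n → ZMod 2} {s : State}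

/-- An unsatisfied check sees an error, there are at most `cD` such checks, and each has `d`
neighbours. -/
theorem Ready.length_le {us : List (Fin n)} (hs : Ready A C x us s) (hy : y ∈ tannerCode A C) :
    us.length ≤ d * (c * hammingDist x y) := by
  classical
  rw [← List.toFinset_card_of_nodup hs.nodup]
  have hsub : us.toFinset ⊆ (Finset.univ.filter fun v => 0 < localErr A x y v).biUnion
      fun v => Finset.univ.image fun i => (A.right v i : Fin n) := by
    intro u hu
    obtain ⟨v, hv, huv⟩ := (hs.mem u).1 (List.mem_toFinset.1 hu)
    obtain ⟨i, hi⟩ := (A.right v).surjective ⟨u, huv⟩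
    simp only [Finset.mem_biUnion, Finset.mem_filter, Finset.mem_univ, true_and, Finset.mem_image]
    exact ⟨v, localErr_pos_of_unsat hy hv, i, congrArg Subtype.val hi⟩
  refine (Finset.card_le_card hsub).trans ((Finset.card_biUnion_le_card_mul _ _ d fun v _ =>
    Finset.card_image_le.trans (by simp)).trans ?_)
  rw [mul_comm, ← sum_localErr (A := A), Finset.card_filter]
  gcongr with v
  split_ifs <;> omega

/-- Subadditivity of `ENNReal.ofReal` allows negative values of `g`, which occur where the potential
exceeds `1`. -/
theorem ofReal_le_tsum_randFlip (f : (Fin n → ZMod 2) → ℝ≥0∞) (g : (Fin n → ZMod 2) → ℝ)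
    (h : ∀ z, ENNReal.ofReal (g z) ≤ f z) :
    ENNReal.ofReal (∑ z : Fin n → ZMod 2, (∏ u, bitWeight A C x u (z u)) * g z) ≤
      ∑' z, randFlip A C x z * f z := by
  rw [tsum_fintype]
  refine (Finset.le_sum_of_subadditive ENNReal.ofReal ENNReal.ofReal_zero.le
    (fun _ _ => ENNReal.ofReal_add_le) _ _).trans (Finset.sum_le_sum fun z _ => ?_)
  rw [ENNReal.ofReal_mul (Finset.prod_nonneg fun u _ => bitWeight_nonneg u _), randFlip_apply]
  gcongr
  exact h z

/-- Strong induction on the budget `b`: a round at distance `D > 0` uses `D` units, each worth a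
constant number of steps, and the final `+ 1` is the exit test. -/
theorem success_le_haltProb {ε α δ : ℝ} (hc : 0 < c) (hd : 0 < d) (hn : 0 < n)
    (h0 : 0 < minDist C) (hG : G.IsExpander c d α δ) (hy : y ∈ tannerCode A C)
    (hε : 0 < ε) (hε1 : ε ≤ 1) (hα : 0 < α) (hεδ : ε ≤ δ - 2 / minDist C) (b : ℕ)
    {us : List (Fin n)} (hs : Ready A C x us s) (hD : (hammingDist x y : ℝ) ≤ α * n) :
    ENNReal.ofReal (1 - potential ε α n (hammingDist x y) b) ≤
      haltProb (holdsWord y) (((8 * (c * d) + 14) * (d * c) + 18) * b + 1)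
        ⟨[mainLoop c C], s⟩ := by
  classical
  have hN : (0 : ℝ) < n := by exact_mod_cast hn
  induction b using Nat.strong_induction_on generalizing x s us with
  | _ b ih =>
  rcases Nat.eq_zero_or_pos (hammingDist x y) with hz | hpos
  · rw [hammingDist_eq_zero] at hz
    subst hz
    have hU : unsat A C x = ∅ := Set.eq_empty_iff_forall_notMem.2 fun v hv => hv (hy v)
    have h1 := (mainLoop_halts (c := c) (l := []) hd hs hU).le_haltProb (holdsWord x)
      (((8 * (c * d) + 14) * (d * c) + 18) * b)
    rw [haltProb_nil, if_pos ((hs.mem_holdsWord x).2 rfl)] at h1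
    refine le_trans (ENNReal.ofReal_le_one.2 ?_) h1
    have : 0 ≤ potential ε α n (hammingDist x x) b := by
      unfold potential
      positivity
    linarith
  rcases Nat.lt_or_ge b (hammingDist x y) with hb | hb
  · have hb' : (b : ℝ) ≤ hammingDist x y := by exact_mod_cast hb.le
    -- When the budget is exhausted, `D - εb ≥ 0` because `ε ≤ 1`, so the bound claimed is trivial.
    have h1 : 1 ≤ potential ε α n (hammingDist x y) b := by
      have h2 : (n : ℝ) ≤ max (hammingDist x y - ε * b + n) 0 := by
        refine le_trans ?_ (le_max_left _ _)
        nlinarith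
      have h3 : 1 ≤ max (hammingDist x y - ε * b + n : ℝ) 0 ^ 2 / (n : ℝ) ^ 2 := by
        rw [le_div_iff₀ (by positivity), one_mul]
        gcongr
      have h4 : 0 ≤ (1 + 1 / (ε * α) ^ 2) / (ε * (n : ℝ) ^ 2) * hammingDist x y := by positivity
      unfold potential
      linarith
    rw [ENNReal.ofReal_of_nonpos (by linarith)]
    exact zero_le
  · have hdrift := drift_le (A := A) hc h0 hG hy hD
    have hpos' : (0 : ℝ) < hammingDist x y := by exact_mod_cast hpos
    have hdrift' : ε * hammingDist x y ≤
        ∑ u, (if x u ≠ y u then 1 else -1) * flipProb A C x u :=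
      (mul_le_mul_of_nonneg_right hεδ hpos'.le).trans hdrift
    -- Positive drift is impossible if all flipping probabilities vanish, so within the radius only
    -- `y` itself satisfies all checks.
    have hU : unsat A C x ≠ ∅ := by
      intro hU
      have h1 : ∑ u, (if x u ≠ y u then 1 else -1) * flipProb A C x u = 0 :=
        Finset.sum_eq_zero fun u _ => by rw [flipProb_eq_zero (by simp [hU]), mul_zero]
      rw [h1] at hdrift'
      exact absurd (mul_pos hε hpos') (not_lt.2 hdrift')
    have hμ : meanDist A C x y ≤ (1 - ε) * hammingDist x y := by
      rw [meanDist_eq]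
      linarith
    have hsum := sum_potential_le (b := b) hc hn hy hε hε1 hα hD hμ
    have hw : ∑ z : Fin n → ZMod 2, ∏ u, bitWeight A C x u (z u) = 1 :=
      sum_prod_weights sum_bitWeight
    refine le_trans ?_ ((((mainLoop_reaches hc hd hs hU) (holdsWord y)
      (((8 * (c * d) + 14) * (d * c) + 18) * (b - hammingDist x y) + 1)
      fun z => ENNReal.ofReal (1 - ((if (hammingDist z y : ℝ) ≤ α * n then 0 else 1) +
        potential ε α n (hammingDist z y) (b - hammingDist x y)))).1 ?_).trans
          (haltProb_mono _ _ ?_))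
    · refine le_trans (ENNReal.ofReal_le_ofReal ?_)
        (ofReal_le_tsum_randFlip _ _ fun z => le_rfl)
      simp_rw [mul_sub, mul_one, Finset.sum_sub_distrib]
      rw [hw]
      exact sub_le_sub_left hsum 1
    · rintro z _ ⟨s', us', rfl, hs'⟩
      split_ifs with hz
      · have := ih (b - hammingDist x y) (by omega) hs' hz
        rw [Nat.cast_sub hb] at this
        rwa [zero_add]
      · have : 0 ≤ potential ε α n (hammingDist z y) (b - hammingDist x y) := by
          unfold potential
          positivity
        rw [ENNReal.ofReal_of_nonpos (by linarith)]
        exact zero_le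
    · have hlen := hs.length_le hy
      have h1 : (8 * (c * d) + 14) * us.length + 18 ≤
          ((8 * (c * d) + 14) * (d * c) + 18) * hammingDist x y := by
        have h2 := Nat.mul_le_mul_left (8 * (c * d) + 14) hlen
        calc (8 * (c * d) + 14) * us.length + 18
            ≤ (8 * (c * d) + 14) * (d * (c * hammingDist x y)) + 18 * hammingDist x y := by omega
          _ = ((8 * (c * d) + 14) * (d * c) + 18) * hammingDist x y := by ring
      have h3 : ((8 * (c * d) + 14) * (d * c) + 18) * b =
          ((8 * (c * d) + 14) * (d * c) + 18) * (b - hammingDist x y) +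
            ((8 * (c * d) + 14) * (d * c) + 18) * hammingDist x y := by
        rw [← mul_add, Nat.sub_add_cancel hb]
      omega

theorem success_le_outputProb {ε α δ : ℝ} {B : ℕ} (hc : 0 < c) (hd : 0 < d) (hn : 0 < n)
    (h0 : 0 < minDist C) (hG : G.IsExpander c d α δ) (hy : y ∈ tannerCode A C)
    (hε : 0 < ε) (hε1 : ε ≤ 1) (hα : 0 < α) (hα1 : α ≤ 1) (hεδ : ε ≤ δ - 2 / minDist C)
    (hB : 2 ≤ ε * B) (hD : (hammingDist x y : ℝ) ≤ α * n) :
    ENNReal.ofReal (1 - (1 + 1 / (ε * α) ^ 2) / ε / n) ≤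
      outputProb (decoder c C) A x
        ((8 * (c * d) + 23 + ((8 * (c * d) + 14) * (d * c) + 18) * B) * n) y := by
  obtain ⟨s, us, h, hs⟩ := init_steps (A := A) (C := C) x
  have hN : (0 : ℝ) < n := by exact_mod_cast hn
  rw [outputProb_eq_haltProb]
  refine le_trans ?_ ((success_le_haltProb hc hd hn h0 hG hy hε hε1 hα hεδ (B * n) hs hD).trans
    ((h.le_haltProb _ _).trans (haltProb_mono _ _ ?_)))
  · refine ENNReal.ofReal_le_ofReal (sub_le_sub_left ?_ 1)
    have hDn : (hammingDist x y : ℝ) ≤ n := hD.trans (by nlinarith)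
    -- With budget `Bn` and `εB ≥ 2` the squared term starts at `0`; only the linear term, of order
    -- `1/n`, remains.
    have h1 : max ((hammingDist x y : ℝ) - ε * (B * n : ℕ) + n) 0 = 0 := by
      refine max_eq_right ?_
      push_cast
      nlinarith
    rw [potential, h1, zero_pow two_ne_zero, zero_div, zero_add]
    calc (1 + 1 / (ε * α) ^ 2) / (ε * (n : ℝ) ^ 2) * hammingDist x y
        ≤ (1 + 1 / (ε * α) ^ 2) / (ε * (n : ℝ) ^ 2) * n := by gcongr
      _ = (1 + 1 / (ε * α) ^ 2) / ε / n := by field_simp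
  -- The additive constant `15` is absorbed using `n ≥ 1`.
  · calc ((8 * (c * d) + 14) * (d * c) + 18) * (B * n) + 1 + ((8 * (c * d) + 8) * n + 14)
        = ((8 * (c * d) + 14) * (d * c) + 18) * (B * n) + (8 * (c * d) + 8) * n + 15 := by ring
      _ ≤ ((8 * (c * d) + 14) * (d * c) + 18) * (B * n) + (8 * (c * d) + 8) * n + 15 * n := by
        omega
      _ = (8 * (c * d) + 23 + ((8 * (c * d) + 14) * (d * c) + 18) * B) * n := by ring

end Success

/-- A lower bound for `δ - 2 / d₀`, for all integers `d₀` for which it is positive. -/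
theorem exists_uniform_drift {δ : ℝ} (hδ : 0 < δ) (hδ1 : δ ≤ 1) :
    ∃ ε : ℝ, 0 < ε ∧ ε ≤ 1 ∧ ∀ k : ℕ, 2 < δ * k → ε ≤ δ - 2 / k := by
  have h1 : 2 / δ < (⌊2 / δ⌋₊ : ℝ) + 1 := Nat.lt_floor_add_one _
  have hpos : (0 : ℝ) < (⌊2 / δ⌋₊ : ℝ) + 1 := by positivity
  -- The least integer above `2/δ` is the worst minimum distance, so `ε` depends on `δ` alone.
  refine ⟨δ - 2 / ((⌊2 / δ⌋₊ : ℝ) + 1), ?_, ?_, fun k hk => ?_⟩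
  · rw [div_lt_iff₀ hδ] at h1
    rw [sub_pos, div_lt_iff₀ hpos]
    linarith
  · have : 0 ≤ 2 / ((⌊2 / δ⌋₊ : ℝ) + 1) := by positivity
    linarith
  · have h2 : 2 / δ < k := by
      rw [div_lt_iff₀ hδ]
      linarith
    have h3 : (⌊2 / δ⌋₊ : ℝ) + 1 ≤ k := by
      exact_mod_cast (Nat.floor_lt (by positivity)).2 h2
    gcongr

end ExpanderDecoding

theorem mainTheorem2 (c d : ℕ) (hc : 0 < c) (hd : 0 < d) :
    ∃ P : Submodule (ZMod 2) (Fin d → ZMod 2) → ExpanderDecoding.Prog,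
      (∀ C₀, ExpanderDecoding.ImplementsRandDecode (P C₀) c d C₀) ∧
      ∀ α δ : ℝ, 0 < α → α ≤ 1 → 0 < δ → δ ≤ 1 →
        ∃ (K : ℕ) (η : ℕ → ℝ), Tendsto η atTop (𝓝 0) ∧
          ∀ C₀ : Submodule (ZMod 2) (Fin d → ZMod 2),
            2 < δ * ExpanderDecoding.minDist C₀ →
            ∀ (n m : ℕ) (G : ExpanderDecoding.BipGraph n m)
              (A : ExpanderDecoding.AdjLists G c d), 0 < n → G.IsExpander c d α δ →
              ∀ x y : Fin n → ZMod 2, y ∈ ExpanderDecoding.tannerCode A C₀ →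
                (hammingDist x y : ℝ) ≤ α * n →
                ENNReal.ofReal (1 - η n) ≤ ExpanderDecoding.randDecodeProb A C₀ x y ∧
                ENNReal.ofReal (1 - η n) ≤
                  ExpanderDecoding.outputProb (P C₀) A x (K * n) y := by
  refine ⟨ExpanderDecoding.decoder c,
    ExpanderDecoding.implementsRandDecode_decoder hc hd, fun α δ hα hα1 hδ hδ1 => ?_⟩
  obtain ⟨ε, hε, hε1, hdrift⟩ := ExpanderDecoding.exists_uniform_drift hδ hδ1
  obtain ⟨B, hB⟩ := exists_nat_ge (2 / ε)
  rw [div_le_iff₀ hε, mul_comm] at hB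
  refine ⟨8 * (c * d) + 23 + ((8 * (c * d) + 14) * (d * c) + 18) * B,
    fun n => (1 + 1 / (ε * α) ^ 2) / ε / n, tendsto_const_div_atTop_nhds_zero_nat _, ?_⟩
  intro C₀ hC n m G A hn hG x y hy hD
  have h0 : 0 < ExpanderDecoding.minDist C₀ := by
    rw [Nat.pos_iff_ne_zero]
    intro h
    rw [h, Nat.cast_zero, mul_zero] at hC
    exact absurd hC (by norm_num)
  have h := ExpanderDecoding.success_le_outputProb hc hd hn h0 hG hy hε hε1 hα hα1
    (hdrift _ hC) hB hD
  refine ⟨?_, h⟩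
  -- The success probability of the algorithm is the supremum over `T` of that of the program.
  rw [← ExpanderDecoding.implementsRandDecode_decoder hc hd C₀ n m G A x y hn]
  exact h.trans (le_iSup (fun T => ExpanderDecoding.outputProb _ A x T y) _)
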